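/- All graphs are finite, undirected, without loops and without parallel edges. A graph is $3$-connected if it has more than three vertices and remains connected whenever fewer than three vertices are deleted; it is claw-free if it has no induced subgraph isomorphic to $K_{1,3}$. A $\Lambda$-factor of a graph $H$ is a spanning subgraph of $H$ each of whose connected components is a $3$-vertex path. Let $G$ be a $3$-connected claw-free graph whose number of vertices $v(G)$ satisfies $v(G) \equiv 2 \pmod 3$, and let $xy$ be an edge of $G$. Then $G - \{x,y\}$, the graph obtained from $G$ by deleting the vertices $x$ and $y$, has a $\Lambda$-factor. -/

import Mathlib

namespace SimpleGraph

/-- The claw `K_{1,3}`. -/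
abbrev claw : SimpleGraph (Fin 1 ⊕ Fin 3) := completeBipartiteGraph (Fin 1) (Fin 3)

/-- A graph is claw-free if it has no induced subgraph isomorphic to `K_{1,3}`. -/
def IsClawFree {V : Type*} (G : SimpleGraph V) : Prop := ¬ claw.IsIndContained G

/-- The graph `G - S` obtained by deleting the vertices in `S` (and all edges meeting `S`). -/
abbrev deleteVertices {V : Type*} (G : SimpleGraph V) (S : Set V) : SimpleGraph ↥(Sᶜ) :=
  G.induce Sᶜ

/-- A graph is `k`-connected if it has more than `k` vertices and remains connected after the
deletion of any set of fewer than `k` vertices. -/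
def IsKVertexConnected {V : Type*} (G : SimpleGraph V) (k : ℕ) : Prop :=
  (k : ℕ∞) < ENat.card V ∧ ∀ S : Set V, S.encard < k → (G.deleteVertices S).Connected

/-- A subgraph `P` of `G` is an `H`-packing of `G` if each of its components is isomorphic
to `H`. -/
def Subgraph.IsPacking {V W : Type*} {G : SimpleGraph V} (P : G.Subgraph)
    (H : SimpleGraph W) : Prop :=
  ∀ C : P.coe.ConnectedComponent, Nonempty (C.toSimpleGraph ≃g H)

/-- An `H`-factor of `G` is a spanning `H`-packing. -/
def Subgraph.IsFactor {V W : Type*} {G : SimpleGraph V} (P : G.Subgraph)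
    (H : SimpleGraph W) : Prop :=
  P.IsPacking H ∧ P.IsSpanning

/-- `G` has a `Λ`-factor, where `Λ` is the path with three vertices. -/
def HasLambdaFactor {V : Type*} (G : SimpleGraph V) : Prop :=
  ∃ P : G.Subgraph, P.IsFactor (pathGraph 3)

end SimpleGraph

namespace SimpleGraph

set_option linter.unusedSectionVars false

/-! ### Ends, chains and path partitions of finite vertex sets -/

section

variable {V : Type*} [DecidableEq V] {G : SimpleGraph V}

/-! The statement that survives induction is about chains: a connected claw-free graph with at most
two end-blocks and order divisible by 3 splits into 3-vertex paths (`IsChain.pathPartition`). Blocks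
are avoided: an end is a set with at most one outside neighbour, and a chain has no three pairwise
separated ends.

`G - {x, y}` is such a chain. If an end with outside neighbour `z` contained no neighbour of `x`,
then `{y, z}` would cut it off from `x`; so three separated ends would give a claw at `x`
(`IsKVertexConnected.isChain_deleteVertices`).

The induction on the order splits `U` into smaller chains of order divisible by 3. By claw-freeness
the neighbours of a cut vertex on one side form a clique, so among pairwise separated ends of that
side it touches at most one; this keeps the pieces chains. There are four cases. A cut vertex with
both sides larger than one vertex, or a 2-cut in a graph without cut vertices: the sides, enlarged
by suitable vertices, are chosen according to their sizes modulo 3 (`IsCut.pathPartition`,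
`NoCutVertex.pathPartition`). A 3-connected graph: a contractible edge extends to a 3-vertex path
whose removal leaves a chain (`NoSmallCut.exists_path`). Cut vertices that only cut off leaves: for
a leaf `d` at `c`, remove a path `d c k`. If the rest is not a chain, split it at a maximal end `S`
whose `k`-neighbours are all `c`-neighbours; `d` and `c` can then be attached to `S` if the sizes
require it (`LeafAt.pathPartition`). -/

/-- The vertex `v` has a neighbour in `S`. -/
def Touches (G : SimpleGraph V) (v : V) (S : Finset V) : Prop := ∃ s ∈ S, G.Adj v s

/-- `S` and `T` are disjoint and no edge joins them. -/
def Sep (G : SimpleGraph V) (S T : Finset V) : Prop := ∀ s ∈ S, ∀ t ∈ T, s ≠ t ∧ ¬ G.Adj s t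

/-- The subgraph induced by `U` is connected (or empty): `U` has no separated bipartition. -/
def ConnOn (G : SimpleGraph V) (U : Finset V) : Prop :=
  ∀ A B : Finset V, A ∪ B = U → A.Nonempty → B.Nonempty → ¬ G.Sep A B

/-- `S` is a nonempty subset of `U` with at most one neighbour in `U \ S`. -/
def IsEnd (G : SimpleGraph V) (U S : Finset V) : Prop :=
  S ⊆ U ∧ S.Nonempty ∧ ∃ z, ∀ s ∈ S, ∀ v ∈ U, v ∉ S → G.Adj s v → v = z

/-- The subgraph induced by `U` is connected with at most two end-blocks. -/
def IsChain (G : SimpleGraph V) (U : Finset V) : Prop :=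
  G.ConnOn U ∧ ∀ X Y Z, G.IsEnd U X → G.IsEnd U Y → G.IsEnd U Z →
    G.Sep X Y → G.Sep X Z → G.Sep Y Z → False

/-- The vertex set `U` can be partitioned into 3-vertex paths of `G`. -/
inductive PathPartition (G : SimpleGraph V) : Finset V → Prop
  | empty : PathPartition G ∅
  | step {U : Finset V} {x y z : V} (hU : PathPartition G U) (hx : x ∉ U) (hy : y ∉ U) (hz : z ∉ U)
      (hxz : x ≠ z) (hxy : G.Adj x y) (hyz : G.Adj y z) : PathPartition G (insert x (insert y (insert z U)))

/-- Among any three neighbours of a vertex, two coincide or are adjacent. -/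
def NoClaw (G : SimpleGraph V) : Prop :=
  ∀ v a b c, G.Adj v a → G.Adj v b → G.Adj v c →
    (a = b ∨ G.Adj a b) ∨ (a = c ∨ G.Adj a c) ∨ (b = c ∨ G.Adj b c)

theorem Sep.symm {S T : Finset V} (h : G.Sep S T) : G.Sep T S :=
  fun s hs t ht => ⟨(h t ht s hs).1.symm, fun hh => (h t ht s hs).2 hh.symm⟩

theorem Sep.mono {S T S' T' : Finset V} (h : G.Sep S T) (hS : S' ⊆ S) (hT : T' ⊆ T) : G.Sep S' T' :=
  fun s hs t ht => h s (hS hs) t (hT ht)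

theorem Sep.union_left {S S' T : Finset V} (h : G.Sep S T) (h' : G.Sep S' T) : G.Sep (S ∪ S') T := by
  intro s hs t ht
  rcases Finset.mem_union.1 hs with hs | hs
  · exact h s hs t ht
  · exact h' s hs t ht

theorem NoClaw.not_touches_three (hG : G.NoClaw) {v : V} {X Y Z : Finset V} (hXY : G.Sep X Y)
    (hXZ : G.Sep X Z) (hYZ : G.Sep Y Z) (hX : G.Touches v X) (hY : G.Touches v Y)
    (hZ : G.Touches v Z) : False := by
  obtain ⟨a, ha, hva⟩ := hX
  obtain ⟨b, hb, hvb⟩ := hY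
  obtain ⟨c, hc, hvc⟩ := hZ
  have h1 := hXY a ha b hb
  have h2 := hXZ a ha c hc
  have h3 := hYZ b hb c hc
  have := hG v a b c hva hvb hvc
  tauto

/-- The neighbours of `v` in `S` form a clique. -/
def CliqueNbrs (G : SimpleGraph V) (v : V) (S : Finset V) : Prop :=
  ∀ a ∈ S, ∀ b ∈ S, G.Adj v a → G.Adj v b → a = b ∨ G.Adj a b

/-- Two distinct nonadjacent neighbours in `S`, with a neighbour in `T`, would form a claw at `v`.
-/
theorem NoClaw.cliqueNbrs (hG : G.NoClaw) {v : V} {S T : Finset V} (hST : G.Sep S T)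
    (hT : G.Touches v T) : G.CliqueNbrs v S := by
  obtain ⟨t, ht, hvt⟩ := hT
  intro a ha b hb hva hvb
  have h1 := hST a ha t ht
  have h2 := hST b hb t ht
  have := hG v a b t hva hvb hvt
  tauto

theorem CliqueNbrs.not_touches_two {v : V} {S X Y : Finset V} (h : G.CliqueNbrs v S) (hX : X ⊆ S)
    (hY : Y ⊆ S) (hXY : G.Sep X Y) (h1 : G.Touches v X) (h2 : G.Touches v Y) : False := by
  obtain ⟨a, ha, hva⟩ := h1
  obtain ⟨b, hb, hvb⟩ := h2
  have h1 := hXY a ha b hb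
  have := h a (hX ha) b (hY hb) hva hvb
  tauto

theorem ConnOn.exists_adj {U A B : Finset V} (hU : G.ConnOn U) (h : A ∪ B = U) (hA : A.Nonempty)
    (hB : B.Nonempty) (hAB : Disjoint A B) : ∃ a ∈ A, ∃ b ∈ B, G.Adj a b := by
  by_contra! hcon
  exact hU A B h hA hB fun a ha b hb => ⟨fun e => Finset.disjoint_left.1 hAB ha (e ▸ hb), hcon a ha b hb⟩

theorem ConnOn.insert {A : Finset V} {c : V} (hA : G.ConnOn A) (hc : G.Touches c A) :
    G.ConnOn (insert c A) := by
  have key : ∀ P R : Finset V, P ∪ R = Insert.insert c A → R.Nonempty → c ∈ P → ¬ G.Sep P R := by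
    intro P R hPR hR hcP hS
    have hcR : c ∉ R := fun h => (hS c hcP c h).1 rfl
    have hu : P.erase c ∪ R = A.erase c := by
      ext v
      have : v ∈ P ∪ R ↔ v ∈ Insert.insert c A := by rw [hPR]
      grind
    by_cases hcA : c ∈ A
    · refine hA P R ?_ ⟨c, hcP⟩ hR hS
      rw [hPR, Finset.insert_eq_of_mem hcA]
    · rw [Finset.erase_eq_of_notMem hcA] at hu
      by_cases hP : (P.erase c).Nonempty
      · exact hA _ _ hu hP hR (hS.mono (Finset.erase_subset _ _) subset_rfl)
      · rw [Finset.not_nonempty_iff_eq_empty.1 hP, Finset.empty_union] at hu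
        subst hu
        obtain ⟨s, hs, hcs⟩ := hc
        exact (hS c hcP s hs).2 hcs
  intro P R hPR hP hR hS
  have hc' : c ∈ P ∪ R := by rw [hPR]; simp
  rcases Finset.mem_union.1 hc' with h | h
  · exact key P R hPR hR h hS
  · exact key R P (by rw [Finset.union_comm, hPR]) hP h hS.symm

/-- A cut vertex `c` has a neighbour on each side of the cut. -/
theorem ConnOn.touches_left {U A B : Finset V} {c : V} (hU : G.ConnOn U) (hc : c ∈ U)
    (hAB : A ∪ B = U.erase c) (hA : A.Nonempty) (hS : G.Sep A B) : G.Touches c A := by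
  have hcA : c ∉ A := fun h => by
    have : c ∈ U.erase c := by rw [← hAB]; simp [h]
    simp at this
  obtain ⟨a, ha, b, hb, hab⟩ := hU.exists_adj (A := A) (B := Insert.insert c B)
    (by rw [Finset.union_insert, hAB, Finset.insert_erase hc]) hA ⟨c, by simp⟩ (by
      rw [Finset.disjoint_left]
      intro v hv hv'
      rcases Finset.mem_insert.1 hv' with rfl | h
      · exact hcA hv
      · exact (hS v hv v h).1 rfl)
  rcases Finset.mem_insert.1 hb with rfl | h
  · exact ⟨a, ha, hab.symm⟩
  · exact absurd hab (hS a ha b h).2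

theorem PathPartition.union {S T : Finset V} (hS : G.PathPartition S) (hT : G.PathPartition T)
    (h : Disjoint S T) : G.PathPartition (S ∪ T) := by
  induction hS with
  | empty => simpa
  | @step U x y z hU hx hy hz hxz hxy hyz ih =>
    simp only [Finset.disjoint_insert_left] at h
    obtain ⟨h1, h2, h3, h4⟩ := h
    simp only [Finset.insert_union]
    exact (ih h4).step (by simp [hx, h1]) (by simp [hy, h2]) (by simp [hz, h3]) hxz hxy hyz

theorem PathPartition.of_erase {U : Finset V} {x y z : V} (hx : x ∈ U) (hy : y ∈ U) (hz : z ∈ U)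
    (hxz : x ≠ z) (hxy : G.Adj x y) (hyz : G.Adj y z)
    (h : G.PathPartition (U \ {x, y, z})) : G.PathPartition U := by
  have := h.step (x := x) (y := y) (z := z) (by simp) (by simp) (by simp) hxz hxy hyz
  convert this using 1
  ext v
  grind

/-- A leaf `b` attached at `c` lies in a path `b c a` of any path partition. -/
theorem PathPartition.exists_of_leaf {W : Finset V} (h : G.PathPartition W) {b c : V} (hb : b ∈ W)
    (hbc : ∀ v ∈ W, G.Adj b v → v = c) :
    c ∈ W ∧ ∃ a ∈ W, a ≠ b ∧ G.Adj c a ∧ G.PathPartition (W \ {b, c, a}) := by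
  induction h with
  | empty => simp at hb
  | @step U x y z hU hx hy hz hxz hxy hyz ih =>
    by_cases hbU : b ∈ U
    · obtain ⟨hc, a, ha, hab, hca, hp⟩ := ih hbU fun v hv => hbc v (by simp [hv])
      refine ⟨by simp [hc], a, by simp [ha], hab, hca, ?_⟩
      have := hp.step (x := x) (y := y) (z := z) (by simp [hx]) (by simp [hy]) (by simp [hz]) hxz hxy hyz
      have h1 := ne_of_mem_of_not_mem ha hx
      have h2 := ne_of_mem_of_not_mem ha hy
      have h3 := ne_of_mem_of_not_mem ha hz
      have h4 := ne_of_mem_of_not_mem hc hx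
      have h5 := ne_of_mem_of_not_mem hc hy
      have h6 := ne_of_mem_of_not_mem hc hz
      have h7 := ne_of_mem_of_not_mem hbU hx
      have h8 := ne_of_mem_of_not_mem hbU hy
      have h9 := ne_of_mem_of_not_mem hbU hz
      convert this using 1
      ext v
      simp only [Finset.mem_insert, Finset.mem_sdiff, Finset.mem_singleton]
      clear this ih hp hbc
      grind
    · have hxy' := hxy.ne
      have hyz' := hyz.ne
      have aux : ∀ a, U = (insert x (insert y (insert z U))) \ {b, c, a} →
          G.PathPartition ((insert x (insert y (insert z U))) \ {b, c, a}) := fun a h => h ▸ hU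
      simp only [Finset.mem_insert, hbU, or_false] at hb
      rcases hb with rfl | rfl | rfl
      · have := hbc y (by simp) hxy
        subst this
        refine ⟨by simp, z, by simp, hxz.symm, hyz, aux _ ?_⟩
        ext v; grind
      · have h1 := hbc z (by simp) hyz
        have h2 := hbc x (by simp) hxy.symm
        exact absurd (h2.trans h1.symm) hxz
      · have := hbc y (by simp) hyz.symm
        subst this
        refine ⟨by simp, x, by simp, hxz, hxy.symm, aux _ ?_⟩
        ext v; grind

/-- Ends move between vertex sets this way: every outside neighbour of `Y` is already an outside
neighbour of `X` in `W`, so the same `z` serves. -/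
theorem IsEnd.extend {W X U Y : Finset V} (h : G.IsEnd W X) (hXY : X ⊆ Y) (hYU : Y ⊆ U)
    (hN : ∀ s ∈ Y, ∀ v ∈ U, v ∉ Y → G.Adj s v → v ∈ W ∧ G.Touches v X) : G.IsEnd U Y := by
  obtain ⟨-, hne, z, hz⟩ := h
  refine ⟨hYU, hne.mono hXY, z, fun s hs v hv hvY hsv => ?_⟩
  obtain ⟨hvW, x, hx, hvx⟩ := hN s hs v hv hvY hsv
  exact hz x hx v hvW (fun h => hvY (hXY h)) hvx.symm

theorem IsEnd.transfer {W X U : Finset V} (h : G.IsEnd W X) (hXU : X ⊆ U)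
    (hN : ∀ s ∈ X, ∀ v ∈ U, v ∉ X → G.Adj s v → v ∈ W) : G.IsEnd U X :=
  h.extend subset_rfl hXU fun s hs v hv hvX hsv => ⟨hN s hs v hv hvX hsv, s, hs, hsv.symm⟩

/-- Of three pairwise separated ends at most one has `p`, and it may be called `X`. In use, `p` says
that the end contains or touches a cut vertex. -/
theorem IsChain.of_cases {U : Finset V} (hU : G.ConnOn U) (p : Finset V → Prop)
    (h : ∀ X Y Z, G.IsEnd U X → G.IsEnd U Y → G.IsEnd U Z →
      G.Sep X Y → G.Sep X Z → G.Sep Y Z → ¬ p Y → ¬ p Z → False)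
    (hp : ∀ X Y, X ⊆ U → Y ⊆ U → G.Sep X Y → ¬ (p X ∧ p Y)) : G.IsChain U := by
  refine ⟨hU, fun X Y Z hX hY hZ hXY hXZ hYZ => ?_⟩
  have h1 := hp X Y hX.1 hY.1 hXY
  have h2 := hp X Z hX.1 hZ.1 hXZ
  have h3 := hp Y Z hY.1 hZ.1 hYZ
  by_cases hpX : p X
  · exact h X Y Z hX hY hZ hXY hXZ hYZ (by tauto) (by tauto)
  · by_cases hpY : p Y
    · exact h Y X Z hY hX hZ hXY.symm hYZ hXZ (by tauto) (by tauto)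
    · exact h Z X Y hZ hX hY hXZ.symm hYZ.symm hXY (by tauto) (by tauto)

theorem Sep.notMem {X Y : Finset V} (h : G.Sep X Y) {c : V} : ¬ (c ∈ X ∧ c ∈ Y) :=
  fun hh => (h c hh.1 c hh.2).1 rfl

/-! ### Sides of a cut vertex -/

/-- `c` is a cut vertex of `U` with separated sides `A` and `B`. -/
structure IsCut (G : SimpleGraph V) (U : Finset V) (c : V) (A B : Finset V) : Prop where
  mem : c ∈ U
  union : A ∪ B = U.erase c
  left : A.Nonempty
  right : B.Nonempty
  sep : G.Sep A B

namespace IsCut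

variable {U A B : Finset V} {c : V}

theorem symm (h : G.IsCut U c A B) : G.IsCut U c B A :=
  ⟨h.mem, by rw [Finset.union_comm, h.union], h.right, h.left, h.sep.symm⟩

theorem mem_iff (h : G.IsCut U c A B) {v : V} : v ∈ U ↔ v = c ∨ v ∈ A ∨ v ∈ B := by
  have h1 : v ∈ A ∪ B ↔ v ∈ U.erase c := by rw [h.union]
  have := h.mem
  grind

theorem notMem_left (h : G.IsCut U c A B) : c ∉ A := by
  intro hc
  have : c ∈ A ∪ B := Finset.mem_union_left _ hc
  rw [h.union] at this
  simp at this

theorem notMem_right (h : G.IsCut U c A B) : c ∉ B := h.symm.notMem_left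

theorem card (h : G.IsCut U c A B) : A.card + B.card + 1 = U.card := by
  rw [← Finset.card_union_of_disjoint, h.union, Finset.card_erase_add_one h.mem]
  rw [Finset.disjoint_left]
  exact fun v hv hv' => h.sep.notMem ⟨hv, hv'⟩

theorem touches_left (h : G.IsCut U c A B) (hU : G.ConnOn U) : G.Touches c A :=
  hU.touches_left h.mem h.union h.left h.sep

theorem touches_right (h : G.IsCut U c A B) (hU : G.ConnOn U) : G.Touches c B :=
  h.symm.touches_left hU

/-- If `A` fell apart, `c` would have neighbours in two parts of `A` and in `B`: a claw. -/
theorem conn_left (h : G.IsCut U c A B) (hU : G.ConnOn U) (hG : G.NoClaw) : G.ConnOn A := by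
  intro P R hPR hP hR hS
  subst hPR
  have hPB := h.sep.mono Finset.subset_union_left (subset_refl B)
  have hRB := h.sep.mono Finset.subset_union_right (subset_refl B)
  refine hG.not_touches_three hS hPB hRB (hU.touches_left (B := R ∪ B) h.mem ?_ hP ?_)
    (hU.touches_left (B := P ∪ B) h.mem ?_ hR ?_) (h.touches_right hU)
  · rw [← Finset.union_assoc, h.union]
  · exact (hS.symm.union_left hPB.symm).symm
  · rw [← Finset.union_assoc, Finset.union_comm R, h.union]
  · exact (hS.union_left hRB.symm).symm

theorem cliqueNbrs_left (h : G.IsCut U c A B) (hU : G.ConnOn U) (hG : G.NoClaw) :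
    G.CliqueNbrs c A := hG.cliqueNbrs h.sep (h.touches_right hU)

theorem isEnd_left (h : G.IsCut U c A B) : G.IsEnd U A := by
  refine ⟨fun v hv => h.mem_iff.2 (by tauto), h.left, c, fun s hs v hv hvA hsv => ?_⟩
  have := h.mem_iff.1 hv
  have := h.sep s hs v
  tauto

/-- An end avoiding `c` is an end of `U` separated from `B`; one containing `c` becomes an end of
`U` after absorbing `B`. -/
theorem chain_insert_left (h : G.IsCut U c A B) (hU : G.IsChain U) (hG : G.NoClaw) :
    G.IsChain (insert c A) := by
  have hm := fun v => h.mem_iff (v := v)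
  have hAB := h.sep
  have tr : ∀ X, G.IsEnd (insert c A) X → c ∉ X → G.IsEnd U X ∧ G.Sep X B := by
    intro X hX hc
    have h1 := hX.1
    refine ⟨hX.transfer (fun v hv => (hm v).2 ?_) fun s hs v hv hvX hsv => ?_,
      hAB.mono (fun v hv => ?_) subset_rfl⟩
    · grind
    · have h2 := h1 hs
      have := hAB s
      grind
    · grind
  refine IsChain.of_cases ((h.conn_left hU.1 hG).insert (h.touches_left hU.1)) (c ∈ ·) ?_
    fun X Y _ _ hXY => hXY.notMem
  intro X Y Z hX hY hZ hXY hXZ hYZ hcY hcZ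
  obtain ⟨hY1, hY2⟩ := tr Y hY hcY
  obtain ⟨hZ1, hZ2⟩ := tr Z hZ hcZ
  by_cases hc : c ∈ X
  · refine hU.2 (X ∪ B) Y Z (hX.extend Finset.subset_union_left ?_ ?_) hY1 hZ1
      (hXY.union_left hY2.symm) (hXZ.union_left hZ2.symm) hYZ
    · intro v hv
      have := fun h : v ∈ X => hX.1 h
      grind
    · intro s hs v hv hvX hsv
      have h1 := hAB v
      have h2 := (hm v).1 hv
      simp only [Finset.mem_union] at hs hvX
      refine ⟨by grind, s, ?_, hsv.symm⟩
      rcases hs with hs | hs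
      · exact hs
      · have := fun h => (h1 h s hs).2 hsv.symm
        grind
  · exact hU.2 X Y Z (tr X hX hc).1 hY1 hZ1 hXY hXZ hYZ

/-- An end not touched by `c` is an end of `U`. One touched by `c` absorbs `c` and `B`: the
`c`-neighbours in `A` form a clique, so no new outside neighbour appears. -/
theorem chain_left (h : G.IsCut U c A B) (hU : G.IsChain U) (hG : G.NoClaw) :
    G.IsChain A := by
  have hm := fun v => h.mem_iff (v := v)
  have hAB := h.sep
  have hcl := h.cliqueNbrs_left hU.1 hG
  have tr : ∀ X, G.IsEnd A X → ¬ G.Touches c X → G.IsEnd U X := by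
    intro X hX hc
    have h1 := hX.1
    refine hX.transfer (fun v hv => (hm v).2 ?_) fun s hs v hv hvX hsv => ?_
    · grind
    · have h2 := h1 hs
      have h3 := hAB s h2 v
      rcases (hm v).1 hv with rfl | h | h
      · exact absurd ⟨s, hs, hsv.symm⟩ hc
      · exact h
      · exact absurd hsv (h3 h).2
  refine IsChain.of_cases (h.conn_left hU.1 hG) (G.Touches c ·) ?_
    fun X Y hX hY hXY hh => hcl.not_touches_two hX hY hXY hh.1 hh.2
  intro X Y Z hX hY hZ hXY hXZ hYZ hcY hcZ
  by_cases hc : G.Touches c X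
  · have aux : ∀ Y, Y ⊆ A → G.Sep X Y → ¬ G.Touches c Y → G.Sep (X ∪ insert c B) Y := by
      intro Y hY hXY hc
      refine hXY.union_left fun s hs t ht => ?_
      rcases Finset.mem_insert.1 hs with rfl | hs
      · exact ⟨fun e => h.notMem_left (hY (e ▸ ht)), fun hst => hc ⟨t, ht, hst⟩⟩
      · exact hAB.symm s hs t (hY ht)
    refine hU.2 (X ∪ insert c B) Y Z (hX.extend Finset.subset_union_left ?_ ?_) (tr Y hY hcY)
      (tr Z hZ hcZ) (aux Y hY.1 hXY hcY) (aux Z hZ.1 hXZ hcZ) hYZ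
    · intro v hv
      have := fun h : v ∈ X => hX.1 h
      grind
    · intro s hs v hv hvX hsv
      have h2 := (hm v).1 hv
      simp only [Finset.mem_union, Finset.mem_insert, not_or] at hs hvX
      have hvA : v ∈ A := by tauto
      refine ⟨hvA, ?_⟩
      rcases hs with hs | rfl | hs
      · exact ⟨s, hs, hsv.symm⟩
      · obtain ⟨x, hx, hcx⟩ := hc
        rcases hcl v hvA x (hX.1 hx) hsv hcx with rfl | h
        · exact absurd hx hvX.1
        · exact ⟨x, hx, h⟩
      · exact absurd hsv.symm (hAB v hvA s hs).2
  · exact hU.2 X Y Z (tr X hX hc) (tr Y hY hcY) (tr Z hZ hcZ) hXY hXZ hYZ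

theorem chain_insert_insert_left (h : G.IsCut U c A B) (hU : G.IsChain U) (hG : G.NoClaw) {b : V}
    (hb : b ∈ B) (hcb : G.Adj c b) : G.IsChain (insert b (insert c A)) := by
  have hm := fun v => h.mem_iff (v := v)
  have hAB := h.sep
  have hcA := h.notMem_left
  have hbA : b ∉ A := fun h => hAB.notMem ⟨h, hb⟩
  have hbc : b ≠ c := hcb.ne'
  have hconnA := (h.conn_left hU.1 hG).insert (h.touches_left hU.1)
  have hconn : G.ConnOn (insert b (insert c A)) := hconnA.insert ⟨c, by simp, hcb.symm⟩
  have tr : ∀ X, G.IsEnd (insert b (insert c A)) X → b ∉ X → c ∉ X → G.IsEnd U X ∧ G.Sep X B := by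
    intro X hX hbX hcX
    have h1 := hX.1
    have h4 : X ⊆ A := fun v hv => by have := h1 hv; grind
    refine ⟨hX.transfer (fun v hv => (hm v).2 ?_) fun s hs v hv hvX hsv => ?_,
      hAB.mono h4 subset_rfl⟩
    · grind
    · have h2 := h4 hs
      have := hAB s
      grind
  refine IsChain.of_cases hconn (fun X => c ∈ X ∨ b ∈ X) ?_ ?_
  · intro X Y Z hX hY hZ hXY hXZ hYZ hY' hZ'
    simp only [not_or] at hY' hZ'
    obtain ⟨hY1, hY2⟩ := tr Y hY hY'.2 hY'.1
    obtain ⟨hZ1, hZ2⟩ := tr Z hZ hZ'.2 hZ'.1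
    by_cases hcX : c ∈ X
    · by_cases hbX : b ∈ X
      · refine hU.2 (X ∪ B) Y Z (hX.extend Finset.subset_union_left ?_ ?_) hY1 hZ1
          (hXY.union_left hY2.symm) (hXZ.union_left hZ2.symm) hYZ
        · intro v hv
          have := fun h : v ∈ X => hX.1 h
          grind
        · intro s hs v hv hvX hsv
          have h1 := hAB v
          have h2 := (hm v).1 hv
          simp only [Finset.mem_union] at hs hvX
          refine ⟨by grind, s, ?_, hsv.symm⟩
          rcases hs with hs | hs
          · exact hs
          · have := fun h => (h1 h s hs).2 hsv.symm
            grind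
      -- Here `b` is the only outside neighbour of `X`, so `X` would separate `A` with `c` into two
      -- parts.
      · obtain ⟨-, -, z, hz⟩ := hX
        have hzb := hz c hcX b (by simp) hbX hcb
        subst hzb
        have hYA : Y ⊆ A := fun v hv => by have := hY.1 hv; grind
        obtain ⟨y, hy⟩ := hY.2.1
        refine hconnA (X ∩ insert c A) (insert c A \ X) ?_ ⟨c, by simp [hcX]⟩ ⟨y, ?_⟩ ?_
        · ext v; grind
        · have := hYA hy
          have := hXY.notMem (c := y)
          grind
        · intro s hs t ht
          have h1 := hz s (by grind) t (by grind) (by grind)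
          refine ⟨by grind, fun hst => ?_⟩
          have := h1 hst
          grind
    · by_cases hbX : b ∈ X
      · exact hU.2 B Y Z h.symm.isEnd_left hY1 hZ1 hY2.symm hZ2.symm hYZ
      · exact hU.2 X Y Z (tr X hX hbX hcX).1 hY1 hZ1 hXY hXZ hYZ
  · rintro X Y - - hXY ⟨h1, h2⟩
    have := hXY.notMem (c := c)
    have := hXY.notMem (c := b)
    have h3 := hXY c
    have h4 := hXY b
    rcases h1 with h1 | h1 <;> rcases h2 with h2 | h2
    · tauto
    · exact (h3 h1 b h2).2 hcb
    · exact (h4 h1 c h2).2 hcb.symm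
    · tauto

/-- Gluing path partitions along a cut vertex both of whose sides have size `1` modulo `3`. -/
theorem pathPartition_of_leaves (h : G.IsCut U c A B) {a b : V} (ha : a ∈ A) (hb : b ∈ B)
    (hca : G.Adj c a) (hcb : G.Adj c b) (hA : G.PathPartition (insert b (insert c A)))
    (hB : G.PathPartition (insert a (insert c B))) : G.PathPartition U := by
  have hm := fun v => h.mem_iff (v := v)
  have hAB := h.sep
  obtain ⟨-, a', ha', hab', hca', hpA⟩ := hA.exists_of_leaf (b := b) (c := c) (by simp) (by
    intro v hv hbv
    have := hAB v
    have := hbv.ne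
    have := hcb.ne
    have := hbv.symm
    grind)
  obtain ⟨-, b', hb', hba', hcb', hpB⟩ := hB.exists_of_leaf (b := a) (c := c) (by simp) (by
    intro v hv hbv
    have := hAB a ha v
    have := hbv.ne
    have := hca.ne
    grind)
  have h1 := h.notMem_left
  have h2 := h.notMem_right
  have hbA : b ∉ A := fun h => hAB.notMem ⟨h, hb⟩
  have haB : a ∉ B := fun h => hAB.notMem ⟨ha, h⟩
  have haA : a' ∈ A := by have := hca'.ne; grind
  have hbB : b' ∈ B := by have := hcb'.ne; grind
  have haB' : a' ∉ B := fun h => hAB.notMem ⟨haA, h⟩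
  have hbA' : b' ∉ A := fun h => hAB.notMem ⟨h, hbB⟩
  have hd : ∀ v, ¬ (v ∈ A ∧ v ∈ B) := fun v => hAB.notMem
  -- Both partitions use `c`. Dropping `b c a'` and `a c b'` leaves partitions of `A - a'` and `B -
  -- b'`, which `a' c b'` completes.
  refine PathPartition.of_erase (x := a') (y := c) (z := b') ((hm _).2 (by tauto)) h.mem
    ((hm _).2 (by tauto)) ?_ hca'.symm hcb' ?_
  · rintro rfl; exact haB' hbB
  · have := hpA.union hpB (by
      rw [Finset.disjoint_left]
      intro v hv hv'
      have := hd v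
      grind)
    convert this using 1
    ext v
    have := hm v
    have := hd v
    simp only [Finset.mem_insert, Finset.mem_sdiff, Finset.mem_singleton, Finset.mem_union]
    clear hpA hpB hA hB
    grind

end IsCut

/-! ### Graphs without cut vertices and their 2-cuts -/

/-- The subgraph induced by `U` is connected and has no cut vertex. -/
def NoCutVertex (G : SimpleGraph V) (U : Finset V) : Prop :=
  G.ConnOn U ∧ ∀ c ∈ U, G.ConnOn (U.erase c)

/-- The only outside neighbour of `X` would be a cut vertex: it cannot lie in `Y`, which is
separated from `X`. -/
theorem NoCutVertex.not_isEnd_of_sep {U X Y : Finset V} (hU : G.NoCutVertex U) (hX : G.IsEnd U X)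
    (hYU : Y ⊆ U) (hY : Y.Nonempty) (hS : G.Sep X Y) : False := by
  obtain ⟨hXU, hXne, z, hz⟩ := hX
  obtain ⟨y, hy⟩ := hY
  have hyX : y ∉ X := fun h => hS.notMem ⟨h, hy⟩
  by_cases h : ∃ s ∈ X, G.Adj s z ∧ z ∈ U ∧ z ∉ X
  · obtain ⟨s, hs, hsz, hzU, hzX⟩ := h
    refine hU.2 z hzU X ((U \ X).erase z) ?_ hXne ⟨y, ?_⟩ ?_
    · ext v
      have := fun h : v ∈ X => hXU h
      grind
    · have := hYU hy
      have : y ≠ z := fun e => (hS s hs y hy).2 (e ▸ hsz)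
      grind
    · intro a ha b hb
      simp only [Finset.mem_erase, Finset.mem_sdiff] at hb
      exact ⟨fun e => hb.2.2 (e ▸ ha), fun hab => hb.1 (hz a ha b hb.2.1 hb.2.2 hab)⟩
  · refine hU.1 X (U \ X) (Finset.union_sdiff_of_subset hXU) hXne ⟨y, by simp [hYU hy, hyX]⟩ ?_
    intro a ha b hb
    simp only [Finset.mem_sdiff] at hb
    refine ⟨fun e => hb.2 (e ▸ ha), fun hab => h ⟨a, ha, ?_⟩⟩
    have := hz a ha b hb.1 hb.2 hab
    subst this
    exact ⟨hab, hb⟩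

/-- `p` and `q` each hold for at most one of three separated ends, so some end has neither. -/
theorem IsChain.of_two_cases {W : Finset V} (hW : G.ConnOn W) (p q : Finset V → Prop)
    (hp : ∀ X Y, X ⊆ W → Y ⊆ W → G.Sep X Y → ¬ (p X ∧ p Y))
    (hq : ∀ X Y, X ⊆ W → Y ⊆ W → G.Sep X Y → ¬ (q X ∧ q Y))
    (h : ∀ X Y, G.IsEnd W X → G.IsEnd W Y → G.Sep X Y → ¬ p X → ¬ q X → False) : G.IsChain W := by
  refine ⟨hW, fun X Y Z hX hY hZ hXY hXZ hYZ => ?_⟩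
  have h1 := hp X Y hX.1 hY.1 hXY
  have h2 := hp X Z hX.1 hZ.1 hXZ
  have h3 := hp Y Z hY.1 hZ.1 hYZ
  have k1 := hq X Y hX.1 hY.1 hXY
  have k2 := hq X Z hX.1 hZ.1 hXZ
  have k3 := hq Y Z hY.1 hZ.1 hYZ
  have l1 := h X Y hX hY hXY
  have l2 := h Y X hY hX hXY.symm
  have l3 := h Z X hZ hX hXZ.symm
  tauto

/-- In a graph without cut vertices, a connected piece is a chain as soon as all but two of its
pairwise separated ends keep all their neighbours. -/
theorem NoCutVertex.isChain_of_two_cases {U W : Finset V} (hU : G.NoCutVertex U) (hWU : W ⊆ U)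
    (hW : G.ConnOn W) (p q : Finset V → Prop)
    (hp : ∀ X Y, X ⊆ W → Y ⊆ W → G.Sep X Y → ¬ (p X ∧ p Y))
    (hq : ∀ X Y, X ⊆ W → Y ⊆ W → G.Sep X Y → ¬ (q X ∧ q Y))
    (h : ∀ X ⊆ W, ¬ p X → ¬ q X → ∀ s ∈ X, ∀ v ∈ U, v ∉ X → G.Adj s v → v ∈ W) : G.IsChain W :=
  IsChain.of_two_cases hW p q hp hq fun X _ hX hY hXY hpX hqX =>
    hU.not_isEnd_of_sep (hX.transfer (hX.1.trans hWU) (h X hX.1 hpX hqX)) (hY.1.trans hWU) hY.2.1 hXY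

section TwoCut

variable {U A B : Finset V} {x c : V}

theorem NoCutVertex.isCut_swap (hc : c ∈ U) (h : G.IsCut (U.erase c) x A B) :
    G.IsCut (U.erase x) c A B := by
  refine ⟨?_, ?_, h.left, h.right, h.sep⟩
  · have := h.mem
    grind
  · rw [h.union, Finset.erase_right_comm]

/-- Only ends touched by `x` or `c` lose neighbours in passing to `A`, and each of these two
vertices touches at most one of any separated ends. -/
theorem NoCutVertex.isChain_left (hU : G.NoCutVertex U) (hG : G.NoClaw) (hc : c ∈ U)
    (h : G.IsCut (U.erase c) x A B) : G.IsChain A := by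
  have h' := isCut_swap hc h
  have hx : x ∈ U := Finset.mem_of_mem_erase h.mem
  have hm := fun v => h.mem_iff (v := v)
  have hcx := h.cliqueNbrs_left (hU.2 c hc) hG
  have hcc := h'.cliqueNbrs_left (hU.2 x hx) hG
  refine hU.isChain_of_two_cases ?_ (h.conn_left (hU.2 c hc) hG) (G.Touches x) (G.Touches c)
    (fun X Y hX hY hXY hh => hcx.not_touches_two hX hY hXY hh.1 hh.2)
    (fun X Y hX hY hXY hh => hcc.not_touches_two hX hY hXY hh.1 hh.2) ?_
  · intro v hv
    have := hm v
    grind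
  · intro X hX hp hq s hs v hv hvX hsv
    have h1 : v ≠ x := fun e => hp ⟨s, hs, e ▸ hsv.symm⟩
    have h2 : v ≠ c := fun e => hq ⟨s, hs, e ▸ hsv.symm⟩
    have h3 := hm v
    have := h.sep s (hX hs) v
    grind

theorem NoCutVertex.isChain_insert_left (hU : G.NoCutVertex U) (hG : G.NoClaw) (hc : c ∈ U)
    (h : G.IsCut (U.erase c) x A B) : G.IsChain (insert c A) := by
  have h' := isCut_swap hc h
  have hx : x ∈ U := Finset.mem_of_mem_erase h.mem
  have hm := fun v => h.mem_iff (v := v)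
  have hcx := h.cliqueNbrs_left (hU.2 c hc) hG
  have hsub : ∀ X : Finset V, X ⊆ insert c A → c ∉ X → X ⊆ A := fun X hX hcX v hv => by
    have := hX hv
    grind
  refine hU.isChain_of_two_cases ?_ ((h.conn_left (hU.2 c hc) hG).insert
    (h'.touches_left (hU.2 x hx))) (c ∈ ·) (fun X => c ∉ X ∧ G.Touches x X)
    (fun X Y _ _ hXY => hXY.notMem)
    (fun X Y hX hY hXY hh => hcx.not_touches_two (hsub X hX hh.1.1) (hsub Y hY hh.2.1) hXY
      hh.1.2 hh.2.2) ?_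
  · intro v hv
    have := hm v
    grind
  · intro X hX hp hq s hs v hv hvX hsv
    have h1 : v ≠ x := fun e => hq ⟨hp, s, hs, e ▸ hsv.symm⟩
    have h3 := hm v
    have := h.sep s (hsub X hX hp hs) v
    grind

theorem NoCutVertex.isChain_insert_insert_left (hU : G.NoCutVertex U) (hG : G.NoClaw) (hc : c ∈ U)
    (h : G.IsCut (U.erase c) x A B) : G.IsChain (insert x (insert c A)) := by
  have h' := isCut_swap hc h
  have hx : x ∈ U := Finset.mem_of_mem_erase h.mem
  have hm := fun v => h.mem_iff (v := v)
  obtain ⟨a, ha, hxa⟩ := h.touches_left (hU.2 c hc)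
  refine hU.isChain_of_two_cases ?_ (((h.conn_left (hU.2 c hc) hG).insert
    (h'.touches_left (hU.2 x hx))).insert ⟨a, by simp [ha], hxa⟩) (x ∈ ·) (c ∈ ·)
    (fun X Y _ _ hXY => hXY.notMem) (fun X Y _ _ hXY => hXY.notMem) ?_
  · intro v hv
    have := hm v
    grind
  · intro X hX hp hq s hs v hv hvX hsv
    have h3 := hm v
    have h4 := hX hs
    have := h.sep s
    grind

end TwoCut

/-! ### The 3-connected case: contractible edges -/

/-- The subgraph induced by `U` remains connected after deleting at most two vertices. -/
def NoSmallCut (G : SimpleGraph V) (U : Finset V) : Prop :=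
  G.NoCutVertex U ∧ ∀ x ∈ U, ∀ y ∈ U, x ≠ y → G.ConnOn (U \ {x, y})

/-- A vertex of `A ∩ B'` would be cut off from `u` by `{c, v}`: since `x ∈ A'` and `x`, `y` are
adjacent, neither lies in `B'`, and `u` has no neighbour in `A`. -/
theorem NoSmallCut.subset_side {U A B A' B' : Finset V} {x y c u v : V} (hU : G.NoSmallCut U)
    (hc : c ∈ U) (hu : u ∈ B) (hv : v ∈ U) (hcv : v ≠ c) (huv : v ≠ u) (hxy : G.Adj x y)
    (hyU : y ∈ U) (hcy : c ≠ y)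
    (hAB : A ∪ B = U \ {x, y, c}) (hS : G.Sep A B)
    (hAB' : A' ∪ B' = U \ {c, u, v}) (hS' : G.Sep A' B') (hx : x ∈ A') :
    (A ∪ {x, y}).erase v ⊆ A' := by
  have hm : ∀ w, w ∈ A ∪ B ↔ w ∈ U \ {x, y, c} := fun w => by rw [hAB]
  have hm' : ∀ w, w ∈ A' ∪ B' ↔ w ∈ U \ {c, u, v} := fun w => by rw [hAB']
  simp only [Finset.mem_union, Finset.mem_sdiff, Finset.mem_insert, Finset.mem_singleton,
    not_or] at hm hm'
  have huA : u ∉ A := fun h => hS.notMem ⟨h, hu⟩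
  have huU := (hm u).1 (Or.inr hu)
  have hyB : y ∉ B' := fun h => (hS' x hx y h).2 hxy
  have hxB : x ∉ B' := fun h => hS'.notMem ⟨hx, h⟩
  intro w hw
  by_contra hwA
  simp only [Finset.mem_erase, Finset.mem_union, Finset.mem_insert, Finset.mem_singleton] at hw
  by_cases hwAA : w ∈ A
  · refine hU.2 c hc v hv hcv.symm (A ∩ B') ((U \ {c, v}) \ (A ∩ B')) ?_ ⟨w, ?_⟩ ⟨u, ?_⟩ ?_
    · apply Finset.union_sdiff_of_subset
      intro t ht
      simp only [Finset.mem_inter] at ht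
      have h1 := (hm' t).1 (Or.inr ht.2)
      simp [h1]
    · have hwu : w ≠ u := fun e => huA (e ▸ hwAA)
      have h1 := (hm w).1 (Or.inl hwAA)
      exact Finset.mem_inter.2 ⟨hwAA, ((hm' w).2 ⟨h1.1, h1.2.2.2, hwu, hw.1⟩).resolve_left hwA⟩
    · simp only [Finset.mem_sdiff, Finset.mem_insert, Finset.mem_singleton, Finset.mem_inter]
      exact ⟨⟨huU.1, fun h => h.elim huU.2.2.2 huv.symm⟩, fun h => huA h.1⟩
    · intro a ha b hb
      simp only [Finset.mem_sdiff, Finset.mem_insert, Finset.mem_singleton, Finset.mem_inter, not_or] at ha hb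
      refine ⟨fun e => hb.2 (e ▸ ha), fun hab => ?_⟩
      have hbA' : b ∉ A' := fun h => (hS' b h a ha.2).2 hab.symm
      have hbB : b ∉ B := fun h => (hS a ha.1 b h).2 hab
      have hbu : b ≠ u := fun e => hbB (e ▸ hu)
      have hbB' : b ∈ B' := ((hm' b).2 ⟨hb.1.1, hb.1.2.1, hbu, hb.1.2.2⟩).resolve_left hbA'
      have hbA : b ∉ A := fun h => hb.2 ⟨h, hbB'⟩
      have hbx : b ≠ x := fun e => hxB (e ▸ hbB')
      have hby : b ≠ y := fun e => hyB (e ▸ hbB')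
      exact ((hm b).2 ⟨hb.1.1, hbx, hby, hb.1.2.1⟩).elim hbA hbB
  · have hwxy : w = y := by
      rcases hw.2 with h | rfl | h
      · exact absurd h hwAA
      · exact absurd hx hwA
      · exact h
    subst hwxy
    rcases (hm' w).2 ⟨hyU, hcy.symm, fun e => huU.2.2.1 e.symm, hw.1⟩ with h | h
    · exact hwA h
    · exact hyB h

/-- Choose `u` in `B` adjacent to `c` and a 3-cut `{c, u, v}`. One side of it contains `A ∪ {x, y}`
except possibly `v`, hence at least `A.card + 1` vertices. -/
theorem NoSmallCut.exists_larger_side {U A B : Finset V} {x y c : V} (hU : G.NoSmallCut U)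
    (hx : x ∈ U) (hy : y ∈ U) (hc : c ∈ U) (hxy : G.Adj x y) (hcx : c ≠ x) (hcy : c ≠ y)
    (hAB : A ∪ B = U \ {x, y, c}) (hS : G.Sep A B) (hA : A.Nonempty) (hB : B.Nonempty)
    (hcut : ∀ x ∈ U, ∀ y ∈ U, G.Adj x y → ∃ c ∈ U, c ≠ x ∧ c ≠ y ∧ ¬ G.ConnOn (U \ {x, y, c})) :
    ∃ u ∈ U, ∃ v ∈ U, G.Adj c u ∧ v ≠ c ∧ v ≠ u ∧ ∃ A' B' : Finset V, A' ∪ B' = U \ {c, u, v} ∧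
      G.Sep A' B' ∧ A'.Nonempty ∧ B'.Nonempty ∧ A.card < A'.card := by
  have hm : ∀ w, w ∈ A ∪ B ↔ w ∈ U \ {x, y, c} := fun w => by rw [hAB]
  simp only [Finset.mem_union, Finset.mem_sdiff, Finset.mem_insert, Finset.mem_singleton,
    not_or] at hm
  have hcut1 : G.IsCut (U \ {x, y}) c A B := ⟨by simp [hc, hcx, hcy], by
    rw [hAB]; ext w; simp only [Finset.mem_sdiff, Finset.mem_insert, Finset.mem_singleton,
      Finset.mem_erase]; tauto, hA, hB, hS⟩
  obtain ⟨u, hu, hcu⟩ := hcut1.touches_right (hU.2 x hx y hy hxy.ne)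
  have huU := (hm u).1 (Or.inr hu)
  obtain ⟨v, hv, hvc, hvu, hconn⟩ := hcut c hc u huU.1 hcu
  simp only [ConnOn, not_forall, not_not] at hconn
  obtain ⟨A', B', hAB', hA', hB', hS'⟩ := hconn
  have hm' : ∀ w, w ∈ A' ∪ B' ↔ w ∈ U \ {c, u, v} := fun w => by rw [hAB']
  simp only [Finset.mem_union, Finset.mem_sdiff, Finset.mem_insert, Finset.mem_singleton,
    not_or] at hm'
  have hcard : A.card < ((A ∪ {x, y}).erase v).card := by
    have h1 : (A ∪ {x, y}).card = A.card + 2 := by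
      rw [Finset.card_union_of_disjoint, Finset.card_pair hxy.ne]
      rw [Finset.disjoint_left]
      intro w hw
      have := (hm w).1 (Or.inl hw)
      simp [this.2.1, this.2.2.1]
    have := Finset.pred_card_le_card_erase (s := A ∪ {x, y}) (a := v)
    omega
  have hsub : (A ∪ {x, y}).erase v ⊆ A' ∨ (A ∪ {x, y}).erase v ⊆ B' := by
    have key : ∀ x y, x ∈ U → y ∈ U → G.Adj x y → c ≠ x → c ≠ y → u ≠ x → x ≠ v →
        A ∪ B = U \ {x, y, c} →
        (A ∪ {x, y}).erase v ⊆ A' ∨ (A ∪ {x, y}).erase v ⊆ B' := by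
      intro x y hx hy hxy hcx hcy hux hxv hAB
      rcases (hm' x).2 ⟨hx, hcx.symm, hux.symm, hxv⟩ with h | h
      · exact Or.inl (hU.subset_side hc hu hv hvc hvu hxy hy hcy hAB hS hAB' hS' h)
      · exact Or.inr (hU.subset_side hc hu hv hvc hvu hxy hy hcy hAB hS
          (by rw [Finset.union_comm, hAB']) hS'.symm h)
    -- If `x` is the third cut vertex, `y` takes its role.
    by_cases hxv : x = v
    · rw [Finset.pair_comm]
      refine key y x hy hx hxy.symm hcy hcx huU.2.2.1 ?_ ?_
      · exact fun e => hxy.ne (hxv.trans e.symm)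
      · rw [hAB, Finset.insert_comm]
    · exact key x y hx hy hxy hcx hcy huU.2.1 hxv hAB
  refine ⟨u, huU.1, v, hv, hcu, hvc, hvu, ?_⟩
  rcases hsub with h | h
  · exact ⟨A', B', hAB', hS', hA', hB', hcard.trans_le (Finset.card_le_card h)⟩
  · exact ⟨B', A', by rw [Finset.union_comm, hAB'], hS'.symm, hB', hA',
      hcard.trans_le (Finset.card_le_card h)⟩

/-- A 3-connected graph has an edge whose ends lie in no 3-vertex cut. -/
theorem NoSmallCut.exists_contractible_edge {U : Finset V} (hU : G.NoSmallCut U)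
    (hcard : 2 ≤ U.card) : ∃ x ∈ U, ∃ y ∈ U, G.Adj x y ∧
      ∀ c ∈ U, c ≠ x → c ≠ y → G.ConnOn (U \ {x, y, c}) := by
  by_contra! hcon
  -- If every edge lay in a 3-cut, enlarging a side repeatedly would exceed any bound.
  have key : ∀ n : ℕ, ∃ x ∈ U, ∃ y ∈ U, ∃ c ∈ U, G.Adj x y ∧ c ≠ x ∧ c ≠ y ∧
      ∃ A B : Finset V, A ∪ B = U \ {x, y, c} ∧ G.Sep A B ∧ A.Nonempty ∧ B.Nonempty ∧
        n ≤ A.card := by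
    intro n
    induction n with
    | zero =>
      obtain ⟨a, ha, b, hb, hab⟩ := Finset.one_lt_card.1 hcard
      obtain ⟨x, hx, y, hy, hxy⟩ := hU.1.1.exists_adj (A := {a}) (B := U.erase a)
        (by ext w; simp only [Finset.mem_union, Finset.mem_singleton, Finset.mem_erase]; grind)
        ⟨a, by simp⟩ ⟨b, by simp [hb, hab.symm]⟩ (by simp)
      obtain rfl := Finset.mem_singleton.1 hx
      have hy := Finset.mem_of_mem_erase hy
      obtain ⟨c, hc, hcx, hcy, h⟩ := hcon x ha y hy hxy
      simp only [ConnOn, not_forall, not_not] at h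
      obtain ⟨A, B, hAB, hA, hB, hS⟩ := h
      exact ⟨x, ha, y, hy, c, hc, hxy, hcx, hcy, A, B, hAB, hS, hA, hB, Nat.zero_le _⟩
    | succ n ih =>
      obtain ⟨x, hx, y, hy, c, hc, hxy, hcx, hcy, A, B, hAB, hS, hA, hB, hn⟩ := ih
      obtain ⟨u, hu, v, hv, hcu, hvc, hvu, A', B', h1, h2, h3, h4, h5⟩ :=
        hU.exists_larger_side hx hy hc hxy hcx hcy hAB hS hA hB hcon
      exact ⟨c, hc, u, hu, v, hv, hcu, hvc, hvu, A', B', h1, h2, h3, h4, by omega⟩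
  obtain ⟨x, hx, y, hy, c, hc, hxy, hcx, hcy, A, B, hAB, hS, hA, hB, hn⟩ := key (U.card + 1)
  have : A.card ≤ U.card := Finset.card_le_card
    (Finset.subset_union_left.trans (hAB.le.trans Finset.sdiff_subset))
  omega

/-- A 3-connected claw-free graph contains a 3-vertex path whose deletion leaves a chain. -/
theorem NoSmallCut.exists_path {U : Finset V} (hU : G.NoSmallCut U) (hG : G.NoClaw)
    (hcard : 3 ≤ U.card) : ∃ x ∈ U, ∃ y ∈ U, ∃ z ∈ U, x ≠ z ∧ G.Adj x y ∧ G.Adj y z ∧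
      G.IsChain (U \ {x, y, z}) := by
  obtain ⟨x, hx, y, hy, hxy, hcon⟩ := hU.exists_contractible_edge (by omega)
  have hne : (U \ {x, y}).Nonempty := by
    rw [← Finset.card_pos]
    have := Finset.le_card_sdiff {x, y} U
    rw [Finset.card_pair hxy.ne] at this
    omega
  obtain ⟨w, hw, z, hz, hwz⟩ := hU.1.1.exists_adj (A := {x, y}) (B := U \ {x, y})
    (by
      apply Finset.union_sdiff_of_subset
      simp [Finset.insert_subset_iff, hx, hy]) ⟨x, by simp⟩ hne Finset.disjoint_sdiff
  simp only [Finset.mem_sdiff, Finset.mem_insert, Finset.mem_singleton, not_or] at hw hz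
  have hee : ∀ v, (U \ {x, y}).erase v = U \ {x, y, v} := by
    intro v
    ext w
    simp only [Finset.mem_sdiff, Finset.mem_insert, Finset.mem_singleton, Finset.mem_erase]
    tauto
  have hncv : G.NoCutVertex (U \ {x, y}) := by
    refine ⟨hU.2 x hx y hy hxy.ne, fun c hc => ?_⟩
    simp only [Finset.mem_sdiff, Finset.mem_insert, Finset.mem_singleton, not_or] at hc
    rw [hee]
    exact hcon c hc.1 hc.2.1 hc.2.2
  have hsub : U \ {x, y, z} ⊆ U \ {x, y} := by
    rw [← hee]; exact Finset.erase_subset _ _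
  -- An end missing `z` would still be an end of `U \ {x, y}`, which has no cut vertex. So three
  -- separated ends give a claw at `z`.
  have htouch : ∀ X Y, G.IsEnd (U \ {x, y, z}) X → G.IsEnd (U \ {x, y, z}) Y → G.Sep X Y →
      G.Touches z X := by
    intro X Y hX hY hXY
    by_contra h
    refine hncv.not_isEnd_of_sep (hX.transfer (hX.1.trans hsub) fun s hs v hv hvX hsv => ?_)
      (hY.1.trans hsub) hY.2.1 hXY
    rw [← hee]
    exact Finset.mem_erase.2 ⟨fun e => h ⟨s, hs, e ▸ hsv.symm⟩, hv⟩
  have hchain : G.IsChain (U \ {x, y, z}) := ⟨hcon z hz.1 hz.2.1 hz.2.2,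
    fun X Y Z hX hY hZ hXY hXZ hYZ => hG.not_touches_three hXY hXZ hYZ (htouch X Y hX hY hXY)
      (htouch Y Z hY hZ hYZ) (htouch Z X hZ hX hXZ.symm)⟩
  rcases hw with rfl | rfl
  · refine ⟨y, hy, w, hx, z, hz.1, fun e => hz.2.2 e.symm, hxy.symm, hwz, ?_⟩
    rwa [Finset.insert_comm]
  · exact ⟨x, hx, w, hy, z, hz.1, fun e => hz.2.1 e.symm, hxy, hwz, hchain⟩

/-! ### Leaves: choosing the path `d c k` -/

/-- A leaf `d` at `c` of the connected claw-free graph induced by `U`, with `U = {c, d} ∪ B`, together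
with a further neighbour `k` of `c` whose deletion leaves `B` connected. -/
structure LeafAt (G : SimpleGraph V) (U B : Finset V) (d c k : V) : Prop where
  noClaw : G.NoClaw
  chain : G.IsChain U
  cut : G.IsCut U c {d} B
  mem : k ∈ B
  adj : G.Adj c k
  conn : G.ConnOn (B.erase k)

/-- The `c`-neighbours in `B` form a clique, so `c` misses one part of `B - k`. Then `k` cuts this
part from `{c, d}` and the rest, and `hP` shrinks it to a single leaf `e`. -/
theorem IsCut.exists_leaf_of_not_connOn {U B : Finset V} {c d k : V} (hU : G.ConnOn U)
    (hG : G.NoClaw) (h : G.IsCut U c {d} B)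
    (hP : ∀ v A' B', G.IsCut U v A' B' → A'.card = 1 ∨ B'.card = 1) (hk : k ∈ B) (hck : G.Adj c k)
    (hconn : ¬ G.ConnOn (B.erase k)) :
    ∃ e ∈ B, e ≠ k ∧ ¬ G.Adj c e ∧ G.Adj k e ∧ ∀ w ∈ U, G.Adj e w → w = k := by
  have hm := fun v => h.mem_iff (v := v)
  have hcl := h.symm.cliqueNbrs_left hU hG
  have hcB := h.notMem_right
  have hdB : d ∉ B := fun hd => h.sep.notMem ⟨by simp, hd⟩
  have hcd : c ≠ d := fun e => h.notMem_left (by simp [e])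
  simp only [ConnOn, not_forall, not_not] at hconn
  have key : ∀ P R : Finset V, P ∪ R = B.erase k → P.Nonempty → R.Nonempty → G.Sep P R →
      ¬ G.Touches c P → ∃ e ∈ B, e ≠ k ∧ ¬ G.Adj c e ∧ G.Adj k e ∧ ∀ w ∈ U, G.Adj e w → w = k := by
    intro P R hPR hPne hR hS hcP
    have hmm : ∀ v, v ∈ P ∪ R ↔ v ∈ B.erase k := fun v => by rw [hPR]
    simp only [Finset.mem_union, Finset.mem_erase] at hmm
    have hcut : G.IsCut U k P (insert c (insert d R)) := by
      refine ⟨(hm k).2 (by tauto), ?_, hPne, ⟨c, by simp⟩, ?_⟩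
      · ext v
        have h1 := hm v
        have h2 := hmm v
        simp only [Finset.mem_union, Finset.mem_insert, Finset.mem_erase, Finset.mem_singleton] at *
        have : c ≠ k := hck.ne
        grind
      · intro s hs t ht
        have hsB := ((hmm s).1 (Or.inl hs)).2
        simp only [Finset.mem_insert] at ht
        rcases ht with rfl | rfl | ht
        · exact ⟨fun e => hcB (e ▸ hsB), fun hst => hcP ⟨s, hs, hst.symm⟩⟩
        · exact h.sep.symm s hsB t (by simp)
        · exact hS s hs t ht
    have hcard : P.card = 1 := by
      refine (hP _ _ _ hcut).resolve_right ?_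
      have := Finset.card_le_card (s := {c, d}) (t := insert c (insert d R)) (by
        intro v hv; simp only [Finset.mem_insert, Finset.mem_singleton] at *; tauto)
      rw [Finset.card_pair hcd] at this
      omega
    obtain ⟨e, rfl⟩ := Finset.card_eq_one.1 hcard
    have he := (hmm e).1 (by simp)
    refine ⟨e, he.2, he.1, fun hce => hcP ⟨e, by simp, hce⟩, ?_, fun w hw hew => ?_⟩
    · obtain ⟨s, hs, hks⟩ := hcut.touches_left hU
      rwa [Finset.mem_singleton.1 hs] at hks
    · rcases hcut.mem_iff.1 hw with h | h | h
      · exact h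
      · rw [Finset.mem_singleton.1 h] at hew
        exact absurd hew (G.irrefl)
      · exact absurd hew (hcut.sep e (by simp) w h).2
  obtain ⟨P, R, hPR, hP1, hR1, hS⟩ := hconn
  have hPB : P ⊆ B := Finset.subset_union_left.trans (hPR.le.trans (Finset.erase_subset _ _))
  have hRB : R ⊆ B := Finset.subset_union_right.trans (hPR.le.trans (Finset.erase_subset _ _))
  by_cases hc : G.Touches c P
  · exact key R P (by rw [Finset.union_comm, hPR]) hR1 hP1 hS.symm
      fun hc' => hcl.not_touches_two hPB hRB hS hc hc'
  · exact key P R hPR hP1 hR1 hS hc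

/-- If every choice of `k` fails, each neighbour of `c` in `B` carries its own leaf. Two such leaves
and `d` are three separated ends; a unique neighbour would be a cut vertex with two large sides. -/
theorem IsCut.exists_leafAt {U B : Finset V} {c d : V} (hU : G.IsChain U)
    (hG : G.NoClaw) (h : G.IsCut U c {d} B)
    (hP : ∀ v A' B', G.IsCut U v A' B' → A'.card = 1 ∨ B'.card = 1) (hB : 3 ≤ B.card) :
    ∃ k, G.LeafAt U B d c k := by
  by_contra! hcon
  have key : ∀ k ∈ B, G.Adj c k →
      ∃ e ∈ B, e ≠ k ∧ ¬ G.Adj c e ∧ G.Adj k e ∧ ∀ w ∈ U, G.Adj e w → w = k := fun k hk hck =>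
    h.exists_leaf_of_not_connOn hU.1 hG hP hk hck fun hconn => hcon k ⟨hG, hU, h, hk, hck, hconn⟩
  have hm := fun v => h.mem_iff (v := v)
  have hcd : c ≠ d := fun e => h.notMem_left (by simp [e])
  have hcB := h.notMem_right
  have hdB : d ∉ B := fun hd => h.sep.notMem ⟨by simp, hd⟩
  obtain ⟨k, hk, hck⟩ := h.touches_right hU.1
  by_cases hone : ∀ k' ∈ B, G.Adj c k' → k' = k
  · have hcut : G.IsCut U k {c, d} (B.erase k) := by
      refine ⟨(hm k).2 (by tauto), ?_, ⟨c, by simp⟩, ?_, ?_⟩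
      · ext v
        have h1 := hm v
        simp only [Finset.mem_union, Finset.mem_insert, Finset.mem_erase, Finset.mem_singleton] at *
        have : c ≠ k := hck.ne
        grind
      · rw [← Finset.card_pos, Finset.card_erase_of_mem hk]; omega
      · intro s hs t ht
        simp only [Finset.mem_insert, Finset.mem_erase, Finset.mem_singleton] at hs ht
        rcases hs with rfl | rfl
        · exact ⟨fun e => hcB (e ▸ ht.2), fun hst => ht.1 (hone t ht.2 hst)⟩
        · exact h.sep s (by simp) t ht.2
    have := hP _ _ _ hcut
    rw [Finset.card_pair hcd, Finset.card_erase_of_mem hk] at this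
    omega
  · push Not at hone
    obtain ⟨k', hk', hck', hkk'⟩ := hone
    obtain ⟨e, he, hek, hce, hke, hew⟩ := key k hk hck
    obtain ⟨e', he', hek', hce', hke', hew'⟩ := key k' hk' hck'
    have hend : ∀ e ∈ B, ∀ k, (∀ w ∈ U, G.Adj e w → w = k) → G.IsEnd U {e} := by
      intro e he k hw
      refine ⟨by simp [hm, he], by simp, k, fun s hs v hv _ hsv => hw v hv ?_⟩
      rwa [← Finset.mem_singleton.1 hs]
    refine hU.2 {d} {e} {e'} h.isEnd_left (hend e he k hew) (hend e' he' k' hew')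
      (h.sep.mono subset_rfl (by simpa)) (h.sep.mono subset_rfl (by simpa)) ?_
    intro s hs t ht
    obtain rfl := Finset.mem_singleton.1 hs
    obtain rfl := Finset.mem_singleton.1 ht
    refine ⟨?_, fun hst => ?_⟩
    · rintro rfl
      exact hkk' (hew k' ((hm _).2 (by tauto)) hke'.symm)
    · have := hew t ((hm _).2 (by tauto)) hst
      subst this
      exact hce' hck

/-! ### Ends of `B - k` and maximal clique ends -/

namespace LeafAt

variable {U B : Finset V} {d c k : V}

theorem cliqueNbrs (h : G.LeafAt U B d c k) : G.CliqueNbrs c B :=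
  h.cut.symm.cliqueNbrs_left h.chain.1 h.noClaw

/-- The `c`-neighbours in `B` are `k` and neighbours of `k`, so an end missed by `k` is missed by
`c` and is an end of `U`. Two of them together with `{d}` would be three separated ends. -/
theorem touches_of_sep (h : G.LeafAt U B d c k) {X Y : Finset V}
    (hX : G.IsEnd (B.erase k) X) (hY : G.IsEnd (B.erase k) Y) (hXY : G.Sep X Y)
    (hkX : ¬ G.Touches k X) : G.Touches k Y := by
  by_contra hkY
  have hm := fun v => h.cut.mem_iff (v := v)
  have tr : ∀ X, G.IsEnd (B.erase k) X → ¬ G.Touches k X → G.IsEnd U X ∧ G.Sep {d} X := by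
    intro X hX hkX
    have hXB : X ⊆ B := hX.1.trans (Finset.erase_subset _ _)
    have hsep : G.Sep {d} X := h.cut.sep.mono subset_rfl hXB
    refine ⟨hX.transfer (fun v hv => (hm v).2 (by have := hXB hv; tauto)) ?_, hsep⟩
    intro s hs v hv hvX hsv
    rcases (hm v).1 hv with rfl | hvd | hvB
    · rcases h.cliqueNbrs k h.mem s (hXB hs) h.adj hsv.symm with rfl | hks
      · exact absurd (hX.1 hs) (by simp)
      · exact absurd ⟨s, hs, hks⟩ hkX
    · exact absurd hsv.symm (hsep v hvd s hs).2
    · exact Finset.mem_erase.2 ⟨fun e => hkX ⟨s, hs, e ▸ hsv.symm⟩, hvB⟩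
  obtain ⟨hX1, hX2⟩ := tr X hX hkX
  obtain ⟨hY1, hY2⟩ := tr Y hY hkY
  exact h.chain.2 {d} X Y h.cut.isEnd_left hX1 hY1 hX2 hY2 hXY

/-- An end of `B - k` all of whose `k`-neighbours are neighbours of `c`. -/
structure CliqueEnd (G : SimpleGraph V) (B : Finset V) (c k : V) (S : Finset V) : Prop where
  isEnd : G.IsEnd (B.erase k) S
  adj_of_adj : ∀ s ∈ S, G.Adj k s → G.Adj c s
  touches : G.Touches k S
  touches_sdiff : G.Touches k (B \ S)
  exists_sep : ∃ E, G.IsEnd (B.erase k) E ∧ ¬ G.Touches k E ∧ G.Sep S E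

/-- Otherwise `k` is the centre of a claw with leaves `c`, `x`, `y`. -/
theorem adj_of_adj_of_sep (h : G.LeafAt U B d c k) {X Y : Finset V} (hX : X ⊆ B) (hY : Y ⊆ B)
    (hXY : G.Sep X Y) : (∀ x ∈ X, G.Adj k x → G.Adj c x) ∨ (∀ y ∈ Y, G.Adj k y → G.Adj c y) := by
  by_contra! hcon
  obtain ⟨⟨x, hx, hkx, hcx⟩, y, hy, hky, hcy⟩ := hcon
  have h1 := hXY x hx y hy
  have h2 : c ≠ x := fun e => h.cut.notMem_right (e ▸ hX hx)
  have h3 : c ≠ y := fun e => h.cut.notMem_right (e ▸ hY hy)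
  have := h.noClaw k c x y h.adj.symm hkx hky
  tauto

/-- Among three separated ends `k` misses one, and hence touches the other two; one of these has all
its `k`-neighbours adjacent to `c`. -/
theorem exists_cliqueEnd (h : G.LeafAt U B d c k) (hB : ¬ G.IsChain (B.erase k)) :
    ∃ S, CliqueEnd G B c k S := by
  have hsub : ∀ {X}, G.IsEnd (B.erase k) X → X ⊆ B := fun hX =>
    hX.1.trans (Finset.erase_subset _ _)
  have hout : ∀ {X Y}, G.Sep X Y → X ⊆ B → G.Touches k X → G.Touches k (B \ Y) := by
    rintro X Y hXY hX ⟨x, hx, hkx⟩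
    exact ⟨x, Finset.mem_sdiff.2 ⟨hX hx, fun hxY => hXY.notMem ⟨hx, hxY⟩⟩, hkx⟩
  have key : ∀ X Y Z, G.IsEnd (B.erase k) X → G.IsEnd (B.erase k) Y → G.IsEnd (B.erase k) Z →
      G.Sep X Y → G.Sep X Z → G.Sep Y Z → ¬ G.Touches k Z → ∃ S, CliqueEnd G B c k S := by
    intro X Y Z hX hY hZ hXY hXZ hYZ hkZ
    have hkX := h.touches_of_sep hZ hX hXZ.symm hkZ
    have hkY := h.touches_of_sep hZ hY hYZ.symm hkZ
    rcases h.adj_of_adj_of_sep (hsub hX) (hsub hY) hXY with h1 | h1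
    · exact ⟨X, hX, h1, hkX, hout hXY.symm (hsub hY) hkY, Z, hZ, hkZ, hXZ⟩
    · exact ⟨Y, hY, h1, hkY, hout hXY (hsub hX) hkX, Z, hZ, hkZ, hYZ⟩
  simp only [IsChain, not_and, not_forall] at hB
  obtain ⟨X, Y, Z, hX, hY, hZ, hXY, hXZ, hYZ, -⟩ := hB h.conn
  by_cases hkX : G.Touches k X
  · by_cases hkY : G.Touches k Y
    · by_cases hkZ : G.Touches k Z
      · exact (h.noClaw.not_touches_three hXY hXZ hYZ hkX hkY hkZ).elim
      · exact key X Y Z hX hY hZ hXY hXZ hYZ hkZ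
    · exact key X Z Y hX hZ hY hXZ hXY hYZ.symm hkY
  · exact key Y Z X hY hZ hX hYZ hXY.symm hXZ.symm hkX

theorem exists_maximal_cliqueEnd (h : G.LeafAt U B d c k) (hB : ¬ G.IsChain (B.erase k)) :
    ∃ S, CliqueEnd G B c k S ∧ ∀ T, CliqueEnd G B c k T → ¬ S ⊂ T := by
  classical
  obtain ⟨S₀, hS₀⟩ := h.exists_cliqueEnd hB
  have hsub : ∀ {S}, CliqueEnd G B c k S → S ⊆ B := fun hS =>
    hS.isEnd.1.trans (Finset.erase_subset _ _)
  obtain ⟨S, hS, hmax⟩ := Finset.exists_max_image (B.powerset.filter (CliqueEnd G B c k))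
    Finset.card ⟨S₀, by simp [hS₀, hsub hS₀]⟩
  refine ⟨S, (Finset.mem_filter.1 hS).2, fun T hT hST => ?_⟩
  have := hmax T (by simp [hT, hsub hT])
  have := Finset.card_lt_card hST
  omega

end LeafAt

namespace LeafAt

variable {U B S R : Finset V} {d c k z : V}

theorem exists_isCut (h : G.LeafAt U B d c k) (hS : CliqueEnd G B c k S) :
    ∃ z R, G.IsCut (B.erase k) z S R := by
  obtain ⟨E, hE, -, hSE⟩ := hS.exists_sep
  obtain ⟨hSW, hSne, z, hz⟩ := hS.isEnd
  have hES : ∀ v ∈ E, v ∉ S := fun v hv hvS => hSE.notMem ⟨hvS, hv⟩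
  obtain ⟨e, he⟩ := hE.2.1
  obtain ⟨s, hs, v, hv, hsv⟩ := h.conn.exists_adj (A := S) (B := B.erase k \ S)
    (Finset.union_sdiff_of_subset hSW) hSne ⟨e, Finset.mem_sdiff.2 ⟨hE.1 he, hES e he⟩⟩
    Finset.disjoint_sdiff
  rw [Finset.mem_sdiff] at hv
  obtain rfl := hz s hs v hv.1 hv.2 hsv
  refine ⟨v, (B.erase k \ S).erase v, hv.1, ?_, hSne, ⟨e, ?_⟩, ?_⟩
  · ext w
    have := fun h : w ∈ S => hSW h
    simp only [Finset.mem_union, Finset.mem_erase, Finset.mem_sdiff] at *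
    grind
  · rw [Finset.mem_erase, Finset.mem_sdiff]
    exact ⟨fun e' => (hSE s hs e he).2 (e' ▸ hsv), hE.1 he, hES e he⟩
  · intro a ha b hb
    rw [Finset.mem_erase, Finset.mem_sdiff] at hb
    exact ⟨fun e => hb.2.2 (e ▸ ha), fun hab => hb.1 (hz a ha b hb.2.1 hb.2.2 hab)⟩

/-- `X` and the end `E` separated from `S` would be two separated ends missed by `k`. -/
theorem not_isEnd_of_sep (h : G.LeafAt U B d c k) (hS : CliqueEnd G B c k S) {X : Finset V}
    (hX : G.IsEnd (B.erase k) X) (hXS : X ⊆ S) (hkX : ¬ G.Touches k X) : False := by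
  obtain ⟨E, hE, hkE, hSE⟩ := hS.exists_sep
  exact hkE (h.touches_of_sep hX hE (hSE.mono hXS subset_rfl) hkX)

/-- `k` touches `T`, hence misses `X` or `Y` and touches the other. A `c`-neighbour in that other
end would be adjacent to one in `S`, so `T` itself would be a clique end, against maximality. -/
theorem not_ssubset (h : G.LeafAt U B d c k) (hS : CliqueEnd G B c k S)
    (hmax : ∀ T, CliqueEnd G B c k T → ¬ S ⊂ T) {T X Y : Finset V} (hST : S ⊂ T)
    (hT : G.IsEnd (B.erase k) T) (hX : G.IsEnd (B.erase k) X) (hY : G.IsEnd (B.erase k) Y)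
    (hTX : G.Sep T X) (hTY : G.Sep T Y) (hXY : G.Sep X Y) : False := by
  have hsub : ∀ {X}, G.IsEnd (B.erase k) X → X ⊆ B := fun hX =>
    hX.1.trans (Finset.erase_subset _ _)
  obtain ⟨s, hs, hks⟩ := hS.touches
  have hkT : G.Touches k T := ⟨s, hST.1 hs, hks⟩
  have key : ∀ X Y, G.IsEnd (B.erase k) X → G.IsEnd (B.erase k) Y → G.Sep T X → G.Sep T Y →
      G.Sep X Y → ¬ G.Touches k Y → False := by
    intro X Y hX hY hTX hTY hXY hkY
    obtain ⟨x, hx, hkx⟩ := h.touches_of_sep hY hX hXY.symm hkY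
    refine hmax T ⟨hT, ?_, hkT, ⟨x, ?_, hkx⟩, Y, hY, hkY, hTY⟩ hST
    · refine (h.adj_of_adj_of_sep (hsub hT) (hsub hX) hTX).resolve_right fun hc => ?_
      have h1 := hTX s (hST.1 hs) x hx
      have := h.cliqueNbrs s (hsub hT (hST.1 hs)) x (hsub hX hx) (hS.adj_of_adj s hs hks) (hc x hx hkx)
      tauto
    · exact Finset.mem_sdiff.2 ⟨hsub hX hx, fun hxT => hTX.notMem ⟨hxT, hx⟩⟩
  by_cases hkX : G.Touches k X
  · by_cases hkY : G.Touches k Y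
    · exact h.noClaw.not_touches_three hTX hTY hXY hkT hkX hkY
    · exact key X Y hX hY hTX hTY hXY hkY
  · exact key Y X hY hX hTY hTX hXY.symm hkX

/-- `k` misses at most one of `X`, `Y`, `Z`; the other two and `S` give a claw at `k`. -/
theorem not_four_ends (h : G.LeafAt U B d c k) (hS : CliqueEnd G B c k S)
    {X Y Z : Finset V} (hX : G.IsEnd (B.erase k) X) (hY : G.IsEnd (B.erase k) Y)
    (hZ : G.IsEnd (B.erase k) Z) (hSX : G.Sep S X) (hSY : G.Sep S Y) (hSZ : G.Sep S Z)
    (hXY : G.Sep X Y) (hXZ : G.Sep X Z) (hYZ : G.Sep Y Z) : False := by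
  have h1 := h.touches_of_sep hX hY hXY
  have h2 := h.touches_of_sep hX hZ hXZ
  have h3 := h.touches_of_sep hY hZ hYZ
  have k1 := h.noClaw.not_touches_three hSX hSY hXY hS.touches
  have k2 := h.noClaw.not_touches_three hSX hSZ hXZ hS.touches
  have k3 := h.noClaw.not_touches_three hSY hSZ hYZ hS.touches
  tauto

theorem isEnd_of_insert_right (hz : G.IsCut (B.erase k) z S R) {X : Finset V}
    (hX : G.IsEnd (insert z R) X) (hzX : z ∉ X) : G.IsEnd (B.erase k) X ∧ G.Sep S X := by
  have hXR : X ⊆ R := fun v hv => by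
    have := hX.1 hv
    grind
  have hsep := hz.sep.mono subset_rfl hXR
  refine ⟨hX.transfer (fun v hv => hz.mem_iff.2 (by have := hXR hv; tauto)) ?_, hsep⟩
  intro s hs v hv hvX hsv
  rcases hz.mem_iff.1 hv with rfl | h | h
  · simp
  · exact absurd hsv.symm (hsep v h s hs).2
  · simp [h]

theorem isEnd_union_of_insert_right (hz : G.IsCut (B.erase k) z S R) {X : Finset V}
    (hX : G.IsEnd (insert z R) X) (hzX : z ∈ X) : G.IsEnd (B.erase k) (X ∪ S) ∧ S ⊂ X ∪ S := by
  refine ⟨hX.extend Finset.subset_union_left ?_ ?_, Finset.subset_union_right, fun hh =>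
    hz.notMem_left (hh (Finset.mem_union_left _ hzX))⟩
  · intro v hv
    have := fun h : v ∈ X => hX.1 h
    have := hz.mem_iff (v := v)
    grind
  · intro s hs v hv hvX hsv
    simp only [Finset.mem_union, not_or] at hs hvX
    have hvR : v ∈ R := by
      rcases hz.mem_iff.1 hv with rfl | h | h
      · exact absurd hzX hvX.1
      · exact absurd h hvX.2
      · exact h
    refine ⟨by simp [hvR], s, ?_, hsv.symm⟩
    exact hs.resolve_right fun hs => (hz.sep s hs v hvR).2 hsv

/-- An end containing `z` absorbs `S`, giving an end that maximality excludes; if no end contains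
`z`, there are four ends with `S`. -/
theorem isChain_insert_right (h : G.LeafAt U B d c k) (hS : CliqueEnd G B c k S)
    (hmax : ∀ T, CliqueEnd G B c k T → ¬ S ⊂ T) (hz : G.IsCut (B.erase k) z S R) :
    G.IsChain (insert z R) := by
  refine IsChain.of_cases ((hz.symm.conn_left h.conn h.noClaw).insert (hz.touches_right h.conn))
    (z ∈ ·) ?_ fun X Y _ _ hXY => hXY.notMem
  intro X Y Z hX hY hZ hXY hXZ hYZ hzY hzZ
  obtain ⟨hY1, hSY⟩ := isEnd_of_insert_right hz hY hzY
  obtain ⟨hZ1, hSZ⟩ := isEnd_of_insert_right hz hZ hzZ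
  by_cases hzX : z ∈ X
  · obtain ⟨h1, h2⟩ := isEnd_union_of_insert_right hz hX hzX
    exact h.not_ssubset hS hmax h2 h1 hY1 hZ1 (hXY.union_left hSY) (hXZ.union_left hSZ) hYZ
  · obtain ⟨hX1, hSX⟩ := isEnd_of_insert_right hz hX hzX
    exact h.not_four_ends hS hX1 hY1 hZ1 hSX hSY hSZ hXY hXZ hYZ

theorem isChain_right (h : G.LeafAt U B d c k) (hS : CliqueEnd G B c k S)
    (hmax : ∀ T, CliqueEnd G B c k T → ¬ S ⊂ T) (hz : G.IsCut (B.erase k) z S R) :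
    G.IsChain R := by
  have hcl := hz.symm.cliqueNbrs_left h.conn h.noClaw
  have hzR := hz.notMem_right
  have tr : ∀ X, G.IsEnd R X → ¬ G.Touches z X → G.IsEnd (insert z R) X ∧ z ∉ X := by
    intro X hX hzX
    refine ⟨hX.transfer (hX.1.trans (Finset.subset_insert _ _)) ?_, fun h => hzR (hX.1 h)⟩
    intro s hs v hv _ hsv
    refine (Finset.mem_insert.1 hv).resolve_left ?_
    rintro rfl
    exact hzX ⟨s, hs, hsv.symm⟩
  refine IsChain.of_cases (hz.symm.conn_left h.conn h.noClaw) (G.Touches z) ?_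
    fun X Y hX hY hXY hh => hcl.not_touches_two hX hY hXY hh.1 hh.2
  intro X Y Z hX hY hZ hXY hXZ hYZ hzY hzZ
  obtain ⟨hY1, hzY1⟩ := tr Y hY hzY
  obtain ⟨hZ1, hzZ1⟩ := tr Z hZ hzZ
  by_cases hzX : G.Touches z X
  · refine (h.isChain_insert_right hS hmax hz).2 (insert z X) Y Z (hX.extend
      (Finset.subset_insert _ _) (Finset.insert_subset_insert _ hX.1) ?_) hY1 hZ1 ?_ ?_ hYZ
    · intro s hs v hv hvX hsv
      simp only [Finset.mem_insert, not_or] at hs hv hvX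
      have hvR : v ∈ R := hv.resolve_left hvX.1
      refine ⟨hvR, ?_⟩
      rcases hs with rfl | hs
      · obtain ⟨x, hx, hzx⟩ := hzX
        rcases hcl v hvR x (hX.1 hx) hsv hzx with rfl | hvx
        · exact absurd hx hvX.2
        · exact ⟨x, hx, hvx⟩
      · exact ⟨s, hs, hsv.symm⟩
    · intro s hs t ht
      rcases Finset.mem_insert.1 hs with rfl | hs
      · exact ⟨fun e => hzY1 (e ▸ ht), fun hst => hzY ⟨t, ht, hst⟩⟩
      · exact hXY s hs t ht
    · intro s hs t ht
      rcases Finset.mem_insert.1 hs with rfl | hs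
      · exact ⟨fun e => hzZ1 (e ▸ ht), fun hst => hzZ ⟨t, ht, hst⟩⟩
      · exact hXZ s hs t ht
  · obtain ⟨hX1, -⟩ := tr X hX hzX
    exact (h.isChain_insert_right hS hmax hz).2 X Y Z hX1 hY1 hZ1 hXY hXZ hYZ

theorem isChain_insert_insert_right (h : G.LeafAt U B d c k) (hS : CliqueEnd G B c k S)
    (hmax : ∀ T, CliqueEnd G B c k T → ¬ S ⊂ T) (hz : G.IsCut (B.erase k) z S R) :
    G.IsChain (insert k (insert z R)) := by
  have hchain := h.isChain_insert_right hS hmax hz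
  have hzR := hz.notMem_right
  have hm := fun v => hz.mem_iff (v := v)
  have hkzR : k ∉ insert z R := fun hk => by
    have := hm k
    simp at this hk
    tauto
  -- This neighbour of `k` outside `S` attaches `k` to `R` with `z`.
  obtain ⟨y, hy, hky⟩ := hS.touches_sdiff
  have hyzR : y ∈ insert z R := by
    have h1 := hm y
    have h2 := hky.ne'
    simp only [Finset.mem_sdiff, Finset.mem_erase, Finset.mem_insert] at *
    tauto
  have tr : ∀ X, G.IsEnd (insert k (insert z R)) X → (X.erase k).Nonempty →
      G.IsEnd (insert z R) (X.erase k) := by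
    rintro X ⟨hXW, -, t, ht⟩ hne
    refine ⟨fun v hv => ?_, hne, t, fun s hs v hv hvX hsv => ?_⟩
    · rw [Finset.mem_erase] at hv
      exact (Finset.mem_insert.1 (hXW hv.2)).resolve_left hv.1
    · refine ht s (Finset.mem_of_mem_erase hs) v (Finset.mem_insert_of_mem hv) (fun hvX' => ?_) hsv
      exact hvX (Finset.mem_erase.2 ⟨fun e => hkzR (e ▸ hv), hvX'⟩)
  have tr' : ∀ X, G.IsEnd (insert k (insert z R)) X → k ∉ X → G.IsEnd (insert z R) X := by
    intro X hX hkX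
    have := tr X hX (by rw [Finset.erase_eq_of_notMem hkX]; exact hX.2.1)
    rwa [Finset.erase_eq_of_notMem hkX] at this
  -- Needed when the third end is `{k}`: then `k` misses `Y` and `Z`, and if `z ∈ Y`, the union `Y ∪
  -- S` would be a larger clique end.
  have big : ∀ Y Z, G.IsEnd (insert z R) Y → G.IsEnd (insert z R) Z → G.Sep Y Z →
      ¬ G.Touches k Y → ¬ G.Touches k Z → z ∈ Y → False := by
    intro Y Z hY hZ hYZ hkY hkZ hzY
    obtain ⟨h1, h2⟩ := isEnd_union_of_insert_right hz hY hzY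
    obtain ⟨hZ1, hSZ⟩ := isEnd_of_insert_right hz hZ fun hzZ => hYZ.notMem ⟨hzY, hzZ⟩
    obtain ⟨s, hs, hks⟩ := hS.touches
    refine hmax (Y ∪ S) ⟨h1, ?_, ⟨s, Finset.mem_union_right _ hs, hks⟩, ⟨y, ?_, hky⟩,
      Z, hZ1, hkZ, hYZ.union_left hSZ⟩ h2
    · intro s hs hks
      rcases Finset.mem_union.1 hs with hs | hs
      · exact absurd ⟨s, hs, hks⟩ hkY
      · exact hS.adj_of_adj s hs hks
    · rw [Finset.mem_sdiff] at hy ⊢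
      exact ⟨hy.1, fun hh => (Finset.mem_union.1 hh).elim (fun hyY => hkY ⟨y, hyY, hky⟩) hy.2⟩
  refine IsChain.of_cases (hchain.1.insert ⟨y, hyzR, hky⟩) (k ∈ ·) ?_ fun X Y _ _ hXY => hXY.notMem
  intro X Y Z hX hY hZ hXY hXZ hYZ hkY hkZ
  have hY' := tr' Y hY hkY
  have hZ' := tr' Z hZ hkZ
  by_cases hne : (X.erase k).Nonempty
  · exact hchain.2 _ Y Z (tr X hX hne) hY' hZ' (hXY.mono (Finset.erase_subset _ _) subset_rfl)
      (hXZ.mono (Finset.erase_subset _ _) subset_rfl) hYZ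
  · have hkX : k ∈ X := by
      by_contra hkX
      rw [Finset.erase_eq_of_notMem hkX] at hne
      exact hne hX.2.1
    have hkY' : ¬ G.Touches k Y := fun ⟨y, hy, hky⟩ => (hXY k hkX y hy).2 hky
    have hkZ' : ¬ G.Touches k Z := fun ⟨y, hy, hky⟩ => (hXZ k hkX y hy).2 hky
    by_cases hzY : z ∈ Y
    · exact big Y Z hY' hZ' hYZ hkY' hkZ' hzY
    · by_cases hzZ : z ∈ Z
      · exact big Z Y hZ' hY' hYZ.symm hkZ' hkY' hzZ
      · exact hkZ' (h.touches_of_sep (isEnd_of_insert_right hz hY' hzY).1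
          (isEnd_of_insert_right hz hZ' hzZ).1 hYZ hkY')

theorem cliqueNbrs_cliqueEnd (h : G.LeafAt U B d c k) (hS : CliqueEnd G B c k S) :
    G.CliqueNbrs k S := fun a ha b hb hka hkb =>
  h.cliqueNbrs a (Finset.mem_of_mem_erase (hS.isEnd.1 ha)) b
    (Finset.mem_of_mem_erase (hS.isEnd.1 hb)) (hS.adj_of_adj a ha hka) (hS.adj_of_adj b hb hkb)

theorem isChain_left (h : G.LeafAt U B d c k) (hS : CliqueEnd G B c k S)
    (hz : G.IsCut (B.erase k) z S R) : G.IsChain S := by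
  have hcl := hz.cliqueNbrs_left h.conn h.noClaw
  have hcl' := h.cliqueNbrs_cliqueEnd hS
  refine IsChain.of_two_cases (hz.conn_left h.conn h.noClaw) (G.Touches z) (G.Touches k)
    (fun X Y hX hY hXY hh => hcl.not_touches_two hX hY hXY hh.1 hh.2)
    (fun X Y hX hY hXY hh => hcl'.not_touches_two hX hY hXY hh.1 hh.2) ?_
  intro X _ hX _ _ hzX hkX
  refine h.not_isEnd_of_sep hS (hX.transfer (hX.1.trans hS.isEnd.1) ?_) hX.1 hkX
  intro s hs v hv _ hsv
  rcases hz.mem_iff.1 hv with rfl | h | h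
  · exact absurd ⟨s, hs, hsv.symm⟩ hzX
  · exact h
  · exact absurd hsv (hz.sep s (hX.1 hs) v h).2

theorem isChain_insert_left (h : G.LeafAt U B d c k) (hS : CliqueEnd G B c k S)
    (hz : G.IsCut (B.erase k) z S R) : G.IsChain (insert z S) := by
  have hcl' := h.cliqueNbrs_cliqueEnd hS
  have hsub : ∀ {X}, X ⊆ insert z S → z ∉ X → X ⊆ S := fun hX hzX v hv => by
    have := hX hv
    grind
  refine IsChain.of_two_cases ((hz.conn_left h.conn h.noClaw).insert (hz.touches_left h.conn))
    (z ∈ ·) (fun X => z ∉ X ∧ G.Touches k X) (fun X Y _ _ hXY => hXY.notMem)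
    (fun X Y hX hY hXY hh => hcl'.not_touches_two (hsub hX hh.1.1) (hsub hY hh.2.1) hXY
      hh.1.2 hh.2.2) ?_
  intro X _ hX _ _ hzX hkX
  have hXS := hsub hX.1 hzX
  refine h.not_isEnd_of_sep hS (hX.transfer (hXS.trans hS.isEnd.1) ?_) hXS fun hh => hkX ⟨hzX, hh⟩
  intro s hs v hv _ hsv
  rcases hz.mem_iff.1 hv with rfl | h | h
  · simp
  · simp [h]
  · exact absurd hsv (hz.sep s (hXS hs) v h).2

/-- Of two separated ends inside `S`, neither touches `c`, since `S` is connected; hence neither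
touches `k`, and both touch `z`. But the `z`-neighbours in `S` form a clique. -/
theorem isChain_insert_insert_left (h : G.LeafAt U B d c k) (hS : CliqueEnd G B c k S)
    (hz : G.IsCut (B.erase k) z S R) : G.IsChain (insert d (insert c S)) := by
  have hcl := hz.cliqueNbrs_left h.conn h.noClaw
  obtain ⟨s₀, hs₀, hks₀⟩ := hS.touches
  have hcd : G.Adj d c := by
    obtain ⟨v, hv, hcv⟩ := h.cut.touches_left h.chain.1
    rw [Finset.mem_singleton.1 hv] at hcv
    exact hcv.symm
  have hconnS := hz.conn_left h.conn h.noClaw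
  have hcS : c ∉ S := fun hh =>
    h.cut.notMem_right (Finset.mem_of_mem_erase (hS.isEnd.1 hh))
  have hsub : ∀ {X}, X ⊆ insert d (insert c S) → ¬ (c ∈ X ∨ d ∈ X) → X ⊆ S := fun hX hcX v hv => by
    have := hX hv
    grind
  refine IsChain.of_cases ((hconnS.insert ⟨s₀, hs₀, hS.adj_of_adj s₀ hs₀ hks₀⟩).insert
    ⟨c, by simp, hcd⟩) (fun X => c ∈ X ∨ d ∈ X) ?_ ?_
  · intro X Y Z hX hY hZ hXY hXZ hYZ hpY hpZ
    have hYS := hsub hY.1 hpY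
    have hZS := hsub hZ.1 hpZ
    have hct : ∀ Y Z, G.IsEnd (insert d (insert c S)) Y → G.IsEnd (insert d (insert c S)) Z →
        Y ⊆ S → Z ⊆ S → G.Sep Y Z → ¬ G.Touches c Y := by
      rintro Y Z ⟨-, hYne, t, ht⟩ hZ hYS hZS hYZ ⟨y, hy, hcy⟩
      have hct := ht y hy c (by simp) (fun hh => hcS (hYS hh)) hcy.symm
      subst hct
      obtain ⟨a, ha⟩ := hZ.2.1
      refine hconnS Y (S \ Y) (Finset.union_sdiff_of_subset hYS) hYne
        ⟨a, Finset.mem_sdiff.2 ⟨hZS ha, fun hh => hYZ.notMem ⟨hh, ha⟩⟩⟩ ?_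
      intro s hs t ht'
      rw [Finset.mem_sdiff] at ht'
      refine ⟨fun e => ht'.2 (e ▸ hs), fun hst => ?_⟩
      have := ht s hs t (by simp [ht'.1]) ht'.2 hst
      exact hcS (this ▸ ht'.1)
    have hz' : ∀ Y, G.IsEnd (insert d (insert c S)) Y → Y ⊆ S → ¬ G.Touches c Y →
        G.Touches z Y := by
      intro Y hY hYS hcY
      by_contra hzY
      refine h.not_isEnd_of_sep hS (hY.transfer (hYS.trans hS.isEnd.1) ?_) hYS ?_
      · intro s hs v hv _ hsv
        rcases hz.mem_iff.1 hv with rfl | h | h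
        · exact absurd ⟨s, hs, hsv.symm⟩ hzY
        · simp [h]
        · exact absurd hsv (hz.sep s (hYS hs) v h).2
      · rintro ⟨y, hy, hky⟩
        exact hcY ⟨y, hy, hS.adj_of_adj y (hYS hy) hky⟩
    exact hcl.not_touches_two hYS hZS hYZ (hz' Y hY hYS (hct Y Z hY hZ hYS hZS hYZ))
      (hz' Z hZ hZS (hct Z Y hZ hY hZS hYS hYZ.symm))
  · rintro X Y - - hXY ⟨h1 | h1, h2 | h2⟩
    · exact hXY.notMem ⟨h1, h2⟩
    · exact (hXY c h1 d h2).2 hcd.symm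
    · exact (hXY d h1 c h2).2 hcd
    · exact hXY.notMem ⟨h1, h2⟩

end LeafAt

/-! ### The induction on the order -/

theorem ConnOn.pathPartition_of_card_eq_three {U : Finset V} (hU : G.ConnOn U) (h : U.card = 3) :
    G.PathPartition U := by
  obtain ⟨x, y, z, hxy, hxz, hyz, rfl⟩ := Finset.card_eq_three.1 h
  have path : ∀ a b c : V, ({a, b, c} : Finset V) = {x, y, z} → a ≠ c → G.Adj a b → G.Adj b c →
      G.PathPartition {x, y, z} := by
    intro a b c he hac hab hbc
    rw [← he]
    refine PathPartition.of_erase (x := a) (y := b) (z := c) (by simp) (by simp) (by simp) hac hab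
      hbc ?_
    rw [Finset.sdiff_self]
    exact .empty
  have nbr : ∀ a b c : V, ({a, b, c} : Finset V) = {x, y, z} → a ≠ b → a ≠ c →
      G.Adj a b ∨ G.Adj a c := by
    intro a b c he hab hac
    obtain ⟨u, hu, v, hv, huv⟩ := hU.exists_adj (A := {a}) (B := {b, c})
      (by rw [← he]; rfl) (by simp) (by simp) (by simp [hab, hac])
    rw [Finset.mem_singleton] at hu
    simp only [Finset.mem_insert, Finset.mem_singleton] at hv
    subst hu
    rcases hv with rfl | rfl
    · exact Or.inl huv
    · exact Or.inr huv
  have e1 : ({y, x, z} : Finset V) = {x, y, z} := by ext; simp; tauto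
  have e2 : ({z, x, y} : Finset V) = {x, y, z} := by ext; simp; tauto
  have e3 : ({x, z, y} : Finset V) = {x, y, z} := by ext; simp; tauto
  have h1 := nbr x y z rfl hxy hxz
  have h2 := nbr y x z e1 hxy.symm hyz
  have h3 := nbr z x y e2 hxz.symm hyz.symm
  have p1 := path x y z rfl hxz
  have p2 := path y x z e1 hyz
  have p3 := path x z y e3 hxy
  simp only [G.adj_comm y x, G.adj_comm z x, G.adj_comm z y] at *
  tauto

theorem ConnOn.exists_isCut {U : Finset V} {c : V} (hc : c ∈ U) (h : ¬ G.ConnOn (U.erase c)) :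
    ∃ A B, G.IsCut U c A B := by
  simp only [ConnOn, not_forall, not_not] at h
  obtain ⟨A, B, hAB, hA, hB, hS⟩ := h
  exact ⟨A, B, hc, hAB, hA, hB, hS⟩

theorem PathPartition.of_union {U A B : Finset V} (hA : G.PathPartition A) (hB : G.PathPartition B)
    (hAB : ∀ v, v ∈ A → v ∉ B) (hU : ∀ v, v ∈ U ↔ v ∈ A ∨ v ∈ B) : G.PathPartition U := by
  have := hA.union hB (Finset.disjoint_left.2 hAB)
  convert this using 1
  ext v
  rw [hU, Finset.mem_union]

/-- The side sizes add up to 2 modulo 3. Sides of size 1 are excluded so that in the case of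
residues 1 and 1 both enlarged sides are smaller than `U`. -/
theorem IsCut.pathPartition {U A B : Finset V} {c : V} (h : G.IsCut U c A B) (hG : G.NoClaw)
    (hU : G.IsChain U) (hcard : U.card % 3 = 0) (hA : A.card ≠ 1) (hB : B.card ≠ 1)
    (ih : ∀ W : Finset V, W.card < U.card → W.card % 3 = 0 → G.IsChain W → G.PathPartition W) :
    G.PathPartition U := by
  have hm := fun v => h.mem_iff (v := v)
  have hd : ∀ v, ¬ (v ∈ A ∧ v ∈ B) := fun v => h.sep.notMem
  have hsum := h.card
  have hcA := h.notMem_left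
  have hcB := h.notMem_right
  have hA0 := Finset.card_pos.2 h.left
  have hB0 := Finset.card_pos.2 h.right
  obtain hA2 | hB2 | hA1 : A.card % 3 = 2 ∨ B.card % 3 = 2 ∨ (A.card % 3 = 1 ∧ B.card % 3 = 1) := by
    omega
  · have hc := Finset.card_insert_of_notMem hcA
    refine (ih (insert c A) (by omega) (by omega) (h.chain_insert_left hU hG)).of_union
      (ih B (by omega) (by omega) (h.symm.chain_left hU hG)) ?_ ?_
    · intro v hv hvB
      rcases Finset.mem_insert.1 hv with rfl | hv
      · exact hcB hvB
      · exact hd v ⟨hv, hvB⟩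
    · intro v
      rw [hm, Finset.mem_insert, or_assoc]
  · have hc := Finset.card_insert_of_notMem hcB
    refine (ih (insert c B) (by omega) (by omega) (h.symm.chain_insert_left hU hG)).of_union
      (ih A (by omega) (by omega) (h.chain_left hU hG)) ?_ ?_
    · intro v hv hvA
      rcases Finset.mem_insert.1 hv with rfl | hv
      · exact hcA hvA
      · exact hd v ⟨hvA, hv⟩
    · intro v
      rw [hm, Finset.mem_insert]
      tauto
  · obtain ⟨a, ha, hca⟩ := h.touches_left hU.1
    obtain ⟨b, hb, hcb⟩ := h.touches_right hU.1
    have h1 : b ∉ insert c A := fun hh => (Finset.mem_insert.1 hh).elim hcb.ne' fun hh => hd b ⟨hh, hb⟩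
    have h2 : a ∉ insert c B := fun hh => (Finset.mem_insert.1 hh).elim hca.ne' fun hh => hd a ⟨ha, hh⟩
    have e1 := Finset.card_insert_of_notMem hcA
    have e2 := Finset.card_insert_of_notMem h1
    have e3 := Finset.card_insert_of_notMem hcB
    have e4 := Finset.card_insert_of_notMem h2
    exact h.pathPartition_of_leaves ha hb hca hcb
      (ih _ (by omega) (by omega) (h.chain_insert_insert_left hU hG hb hcb))
      (ih _ (by omega) (by omega) (h.symm.chain_insert_insert_left hU hG ha hca))

/-- The side sizes add up to 1 modulo 3: either one side is divisible by 3 and the other takes both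
cut vertices, or both are 2 modulo 3 and each takes one. -/
theorem NoCutVertex.pathPartition {U A B : Finset V} {x c : V} (hU : G.NoCutVertex U)
    (hG : G.NoClaw) (hc : c ∈ U) (h : G.IsCut (U.erase c) x A B) (hcard : U.card % 3 = 0)
    (ih : ∀ W : Finset V, W.card < U.card → W.card % 3 = 0 → G.IsChain W → G.PathPartition W) :
    G.PathPartition U := by
  have h' := isCut_swap hc h
  have hm := fun v => h.mem_iff (v := v)
  simp only [Finset.mem_erase] at hm
  have hx := (hm x).2 (Or.inl rfl)
  have hd : ∀ v, ¬ (v ∈ A ∧ v ∈ B) := fun v => h.sep.notMem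
  have hsum := h.card
  rw [Finset.card_erase_of_mem hc] at hsum
  have hU0 := Finset.card_pos.2 ⟨c, hc⟩
  have hA0 := Finset.card_pos.2 h.left
  have hB0 := Finset.card_pos.2 h.right
  have hxA := h.notMem_left
  have hxB := h.notMem_right
  have hcA := h'.notMem_left
  have hcB := h'.notMem_right
  have hmU : ∀ v, v ∈ U ↔ v = x ∨ v = c ∨ v ∈ A ∨ v ∈ B := by
    intro v
    have := hm v
    by_cases hvc : v = c
    · simp [hvc, hc]
    · tauto
  have key : ∀ A B, G.IsCut (U.erase c) x A B → A.card % 3 = 0 → A.card + B.card + 2 = U.card →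
      G.PathPartition U := by
    intro A B h hA hAB
    have h' := isCut_swap hc h
    have hxB := h.notMem_right
    have hcB := h'.notMem_right
    have hxA := h.notMem_left
    have hcA := h'.notMem_left
    have hB0 := Finset.card_pos.2 h.right
    have hA0 := Finset.card_pos.2 h.left
    have h1 : x ∉ insert c B := fun hh => (Finset.mem_insert.1 hh).elim hx.1 hxB
    have e1 := Finset.card_insert_of_notMem hcB
    have e2 := Finset.card_insert_of_notMem h1
    refine (ih A (by omega) hA (hU.isChain_left hG hc h)).of_union
      (ih (insert x (insert c B)) (by omega) (by omega)
        (hU.isChain_insert_insert_left hG hc h.symm)) ?_ ?_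
    · intro v hv hvB
      simp only [Finset.mem_insert] at hvB
      rcases hvB with rfl | rfl | hvB
      · exact hxA hv
      · exact hcA hv
      · exact h.sep.notMem ⟨hv, hvB⟩
    · intro v
      have := h.mem_iff (v := v)
      simp only [Finset.mem_insert, Finset.mem_erase] at *
      by_cases hvc : v = c
      · simp [hvc, hc]
      · tauto
  obtain hA2 | hB2 | hA1 : A.card % 3 = 0 ∨ B.card % 3 = 0 ∨ (A.card % 3 = 2 ∧ B.card % 3 = 2) := by
    omega
  · exact key A B h hA2 (by omega)
  · exact key B A h.symm hB2 (by omega)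
  · have e1 := Finset.card_insert_of_notMem hcA
    have e2 := Finset.card_insert_of_notMem hxB
    refine (ih (insert c A) (by omega) (by omega) (hU.isChain_insert_left hG hc h)).of_union
      (ih (insert x B) (by omega) (by omega) (hU.isChain_insert_left hG hx.2 h'.symm)) ?_ ?_
    · intro v hv hv'
      simp only [Finset.mem_insert] at hv hv'
      rcases hv with rfl | hv <;> rcases hv' with rfl | hv'
      · exact hx.1 rfl
      · exact hcB hv'
      · exact hxA hv
      · exact hd v ⟨hv, hv'⟩
    · intro v
      rw [hmU]
      simp only [Finset.mem_insert]
      tauto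

theorem LeafAt.pathPartition {U B : Finset V} {d c k : V} (h : G.LeafAt U B d c k)
    (hcard : U.card % 3 = 0)
    (ih : ∀ W : Finset V, W.card < U.card → W.card % 3 = 0 → G.IsChain W → G.PathPartition W) :
    G.PathPartition U := by
  have hm := fun v => h.cut.mem_iff (v := v)
  simp only [Finset.mem_singleton] at hm
  have hcd : G.Adj d c := by
    obtain ⟨v, hv, hcv⟩ := h.cut.touches_left h.chain.1
    rw [Finset.mem_singleton.1 hv] at hcv
    exact hcv.symm
  have hcB := h.cut.notMem_right
  have hdB : d ∉ B := fun hd => h.cut.sep.notMem ⟨by simp, hd⟩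
  have hdk : d ≠ k := fun e => hdB (e ▸ h.mem)
  have hsum := h.cut.card
  rw [Finset.card_singleton] at hsum
  have hBcard := Finset.card_erase_add_one h.mem
  have hwrap : G.PathPartition (B.erase k) → G.PathPartition U := by
    intro hp
    refine PathPartition.of_erase ((hm d).2 (by tauto)) ((hm c).2 (by tauto))
      ((hm k).2 (Or.inr (Or.inr h.mem))) hdk hcd h.adj ?_
    convert hp using 1
    ext v
    have := hm v
    simp only [Finset.mem_sdiff, Finset.mem_erase, Finset.mem_insert, Finset.mem_singleton]
    have h1 : v ∈ B → v ≠ c := fun hv e => hcB (e ▸ hv)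
    have h2 : v ∈ B → v ≠ d := fun hv e => hdB (e ▸ hv)
    tauto
  by_cases hchain : G.IsChain (B.erase k)
  · exact hwrap (ih _ (by omega) (by omega) hchain)
  obtain ⟨S, hS, hmax⟩ := h.exists_maximal_cliqueEnd hchain
  obtain ⟨z, R, hz⟩ := h.exists_isCut hS
  have hmz := fun v => hz.mem_iff (v := v)
  simp only [Finset.mem_erase] at hmz
  have hzsum := hz.card
  have hzS := hz.notMem_left
  have hzR := hz.notMem_right
  have hSR : ∀ v, ¬ (v ∈ S ∧ v ∈ R) := fun v => hz.sep.notMem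
  have hSB : ∀ v ∈ S, v ∈ B ∧ v ≠ k := fun v hv => ((hmz v).2 (by tauto)).symm
  have hRB : ∀ v ∈ R, v ∈ B ∧ v ≠ k := fun v hv => ((hmz v).2 (by tauto)).symm
  have hzB : z ∈ B ∧ z ≠ k := ((hmz z).2 (by tauto)).symm
  have eR := Finset.card_insert_of_notMem hzR
  have eS := Finset.card_insert_of_notMem hzS
  obtain hs | hs | hs : S.card % 3 = 0 ∨ S.card % 3 = 2 ∨ S.card % 3 = 1 := by omega
  · refine hwrap ((ih S (by omega) hs (h.isChain_left hS hz)).of_union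
      (ih (insert z R) (by omega) (by omega) (h.isChain_insert_right hS hmax hz)) ?_ ?_)
    · intro v hv hv'
      rcases Finset.mem_insert.1 hv' with rfl | hv'
      · exact hzS hv
      · exact hSR v ⟨hv, hv'⟩
    · intro v
      rw [Finset.mem_erase, hmz, Finset.mem_insert]
      tauto
  · refine hwrap ((ih (insert z S) (by omega) (by omega) (h.isChain_insert_left hS hz)).of_union
      (ih R (by omega) (by omega) (h.isChain_right hS hmax hz)) ?_ ?_)
    · intro v hv hv'
      rcases Finset.mem_insert.1 hv with rfl | hv
      · exact hzR hv'
      · exact hSR v ⟨hv, hv'⟩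
    · intro v
      rw [Finset.mem_erase, hmz, Finset.mem_insert, or_assoc]
  -- With `S` and `R` both 1 modulo 3, the path `d c k` is given up: `d`, `c` join `S`, while `k`,
  -- `z` join `R`.
  · have h1 : c ∉ S := fun hh => hcB (hSB c hh).1
    have h2 : d ∉ insert c S := fun hh => (Finset.mem_insert.1 hh).elim hcd.ne
      fun hh => hdB (hSB d hh).1
    have h3 : k ∉ insert z R := fun hh => (Finset.mem_insert.1 hh).elim hzB.2.symm
      fun hh => (hRB k hh).2 rfl
    have e1 := Finset.card_insert_of_notMem h1
    have e2 := Finset.card_insert_of_notMem h2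
    have e3 := Finset.card_insert_of_notMem h3
    refine (ih (insert d (insert c S)) (by omega) (by omega)
      (h.isChain_insert_insert_left hS hz)).of_union
      (ih (insert k (insert z R)) (by omega) (by omega)
        (h.isChain_insert_insert_right hS hmax hz)) ?_ ?_
    · intro v hv hv'
      have hv'B : v ∈ B := by
        simp only [Finset.mem_insert] at hv'
        rcases hv' with rfl | rfl | hv'
        · exact h.mem
        · exact hzB.1
        · exact (hRB v hv').1
      simp only [Finset.mem_insert] at hv
      rcases hv with rfl | rfl | hv
      · exact hdB hv'B
      · exact hcB hv'B
      · simp only [Finset.mem_insert] at hv'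
        rcases hv' with rfl | rfl | hv'
        · exact (hSB v hv).2 rfl
        · exact hzS hv
        · exact hSR v ⟨hv, hv'⟩
    · intro v
      rw [hm]
      simp only [Finset.mem_insert]
      by_cases hvk : v = k
      · simp [hvk, h.mem]
      · have hvB : v ∈ B ↔ v = z ∨ v ∈ S ∨ v ∈ R := by
          rw [← hmz v]
          exact (and_iff_right hvk).symm
        rw [hvB]
        simp only [hvk, false_or, or_left_comm, or_assoc]

/-- A connected claw-free graph with at most two end-blocks whose number of vertices is divisible
by `3` can be partitioned into 3-vertex paths. -/
theorem IsChain.pathPartition (hG : G.NoClaw) {U : Finset V} (hU : G.IsChain U)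
    (hcard : U.card % 3 = 0) : G.PathPartition U := by
  induction hn : U.card using Nat.strong_induction_on generalizing U with
  | _ n IH =>
  have ih : ∀ W : Finset V, W.card < U.card → W.card % 3 = 0 → G.IsChain W → G.PathPartition W :=
    fun W hW hW3 hWc => IH W.card (hn ▸ hW) hWc hW3 rfl
  clear IH
  by_cases h0 : U.card = 0
  · rw [Finset.card_eq_zero.1 h0]
    exact .empty
  by_cases h3 : U.card = 3
  · exact hU.1.pathPartition_of_card_eq_three h3
  by_cases hP : ∀ v A B, G.IsCut U v A B → A.card = 1 ∨ B.card = 1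
  swap
  · push Not at hP
    obtain ⟨v, A, B, h, hA, hB⟩ := hP
    exact h.pathPartition hG hU hcard hA hB ih
  by_cases hcut : ∃ c A B, G.IsCut U c A B ∧ A.card = 1
  · obtain ⟨c, A, B, h, hA⟩ := hcut
    obtain ⟨d, rfl⟩ := Finset.card_eq_one.1 hA
    have := h.card
    obtain ⟨k, hk⟩ := h.exists_leafAt hU hG hP (by omega)
    exact hk.pathPartition hcard ih
  have hncv : G.NoCutVertex U := by
    refine ⟨hU.1, fun c hc => ?_⟩
    by_contra hcon
    obtain ⟨A, B, h⟩ := ConnOn.exists_isCut hc hcon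
    rcases hP c A B h with h1 | h1
    · exact hcut ⟨c, A, B, h, h1⟩
    · exact hcut ⟨c, B, A, h.symm, h1⟩
  by_cases hsm : ∀ x ∈ U, ∀ y ∈ U, x ≠ y → G.ConnOn (U \ {x, y})
  · obtain ⟨x, hx, y, hy, z, hz, hxz, hxy, hyz, hch⟩ := NoSmallCut.exists_path ⟨hncv, hsm⟩ hG (by omega)
    have hsub : ({x, y, z} : Finset V) ⊆ U := by
      simp [Finset.insert_subset_iff, hx, hy, hz]
    have hc3 : (U \ {x, y, z}).card = U.card - 3 := by
      rw [Finset.card_sdiff_of_subset hsub,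
        Finset.card_eq_three.2 ⟨x, y, z, hxy.ne, hxz, hyz.ne, rfl⟩]
    exact PathPartition.of_erase hx hy hz hxz hxy hyz (ih _ (by omega) (by omega) hch)
  · push Not at hsm
    obtain ⟨x, hx, y, hy, hxy, hcon⟩ := hsm
    have he : U \ {x, y} = (U.erase y).erase x := by
      ext v
      simp only [Finset.mem_sdiff, Finset.mem_insert, Finset.mem_singleton, Finset.mem_erase]
      tauto
    rw [he] at hcon
    obtain ⟨A, B, h⟩ := ConnOn.exists_isCut (Finset.mem_erase.2 ⟨hxy, hx⟩) hcon
    exact hncv.pathPartition hG hy h hcard ih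

end

/-! ### From the 3-connected graph to chains, and from path partitions to factors -/

section

variable {V : Type*} {G : SimpleGraph V}

theorem IsClawFree.noClaw (h : G.IsClawFree) : G.NoClaw := by
  intro v a b c hva hvb hvc
  by_contra! hcon
  obtain ⟨⟨hab, hab'⟩, ⟨hac, hac'⟩, hbc, hbc'⟩ := hcon
  have hba' : ¬ G.Adj b a := fun h => hab' h.symm
  have hca' : ¬ G.Adj c a := fun h => hac' h.symm
  have hcb' : ¬ G.Adj c b := fun h => hbc' h.symm
  have h1 := hva.ne
  have h2 := hvb.ne
  have h3 := hvc.ne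
  refine h ⟨⟨⟨Sum.elim (fun _ => v) ![a, b, c], ?_⟩, ?_⟩⟩
  · rintro (i | i) (j | j) hij
    · simp [Subsingleton.elim i j]
    · fin_cases j <;> simp_all
    · fin_cases i <;> simp_all
    · fin_cases i <;> fin_cases j <;> simp_all
  · intro i j
    change G.Adj (Sum.elim (fun _ => v) ![a, b, c] i) (Sum.elim (fun _ => v) ![a, b, c] j) ↔ _
    rcases i with i | i <;> rcases j with j | j
    · simp
    · fin_cases j <;> simp [*]
    · fin_cases i <;> simp [*, G.adj_comm _ v]
    · fin_cases i <;> fin_cases j <;> simp [*]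

theorem NoClaw.induce (h : G.NoClaw) (S : Set V) : (G.induce S).NoClaw := by
  intro v a b c hva hvb hvc
  simpa [Subtype.ext_iff] using h v a b c hva hvb hvc

theorem Preconnected.exists_adj_of_mem_of_notMem (h : G.Preconnected) {S : Set V} {a b : V}
    (ha : a ∈ S) (hb : b ∉ S) : ∃ u ∈ S, ∃ v, v ∉ S ∧ G.Adj u v := by
  obtain ⟨p⟩ := h a b
  obtain ⟨d, -, h1, h2⟩ := p.exists_boundary_dart S ha hb
  exact ⟨d.fst, h1, d.snd, h2, d.adj⟩

theorem Preconnected.connOn_univ [Fintype V] [DecidableEq V] (h : G.Preconnected) :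
    G.ConnOn Finset.univ := by
  rintro A B hAB ⟨a, ha⟩ ⟨b, hb⟩ hS
  obtain ⟨u, hu, v, hv, huv⟩ := h.exists_adj_of_mem_of_notMem (S := (A : Set V)) (a := a) (b := b)
    (by simpa) fun hbA => hS.notMem ⟨by simpa using hbA, hb⟩
  have hvB : v ∈ A ∪ B := by rw [hAB]; simp
  simp only [Finset.mem_coe] at hu hv
  exact (hS u hu v ((Finset.mem_union.1 hvB).resolve_left hv)).2 huv

theorem IsKVertexConnected.exists_adj_of_isEnd (hG : G.IsKVertexConnected 3) {x y : V} (hxy : x ≠ y)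
    {U X : Finset ↥({x, y}ᶜ : Set V)} (hU : ∀ v, v ∈ U) (hX : (G.deleteVertices {x, y}).IsEnd U X) :
    ∃ s ∈ X, G.Adj x s := by
  by_contra! hcon
  obtain ⟨-, ⟨a, ha⟩, z, hz⟩ := hX
  have hne : ∀ v : ↥({x, y}ᶜ : Set V), (v : V) ≠ x ∧ (v : V) ≠ y := by
    rintro ⟨v, hv⟩
    simpa [not_or] using hv
  -- `z` is deleted only when outside `X`: an end without outside neighbours admits an arbitrary
  -- `z`. The surviving part of `X` is then all of `X`.
  set S : Set V := {v | v = y ∨ (v = z ∧ z ∉ X)} with hS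
  have hcard : S.encard < (3 : ℕ) := by
    have h1 : S ⊆ {y, (z : V)} := by
      rintro v (h | ⟨h, -⟩) <;> simp [h]
    refine (Set.encard_le_encard h1).trans_lt ((Set.encard_pair (hne z).2.symm).trans_lt ?_)
    norm_num
  have hxS : x ∈ Sᶜ := by
    rintro (h | ⟨h, -⟩)
    · exact hxy h
    · exact (hne z).1 h.symm
  have hmemS : ∀ s ∈ X, (s : V) ∈ Sᶜ := by
    rintro s hs (h | ⟨h, h'⟩)
    · exact (hne s).2 h
    · exact h' (Subtype.ext h ▸ hs)
  obtain ⟨⟨u, hu⟩, ⟨s, hs, rfl⟩, ⟨v, hv⟩, hvX, huv⟩ :=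
    (hG.2 S hcard).preconnected.exists_adj_of_mem_of_notMem
      (S := {v | ∃ s ∈ X, (s : V) = v}) (a := ⟨a, hmemS a ha⟩) (b := ⟨x, hxS⟩) ⟨a, ha, rfl⟩
      (by rintro ⟨s, -, h⟩; exact (hne s).1 h)
  have huv : G.Adj s v := huv
  have hvx : v ≠ x := fun e => hcon s hs (e ▸ huv.symm)
  have hvy : v ≠ y := fun e => hv (Or.inl e)
  have hvX' : (⟨v, by simp [hvx, hvy]⟩ : ↥({x, y}ᶜ : Set V)) ∉ X := fun h => hvX ⟨_, h, rfl⟩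
  have := hz s hs ⟨v, by simp [hvx, hvy]⟩ (hU _) hvX' huv
  subst this
  exact hv (Or.inr ⟨rfl, hvX'⟩)

theorem IsKVertexConnected.isChain_deleteVertices [Fintype V] [DecidableEq V]
    (hG : G.IsKVertexConnected 3) (hclaw : G.NoClaw) {x y : V} (hxy : x ≠ y)
    [Fintype ↥({x, y}ᶜ : Set V)] [DecidableEq ↥({x, y}ᶜ : Set V)] :
    (G.deleteVertices {x, y}).IsChain Finset.univ := by
  refine ⟨(hG.2 {x, y} ?_).preconnected.connOn_univ, ?_⟩
  · exact (Set.encard_pair hxy).trans_lt (by norm_num)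
  · intro X Y Z hX hY hZ hXY hXZ hYZ
    obtain ⟨a, ha, hxa⟩ := hG.exists_adj_of_isEnd hxy Finset.mem_univ hX
    obtain ⟨b, hb, hxb⟩ := hG.exists_adj_of_isEnd hxy Finset.mem_univ hY
    obtain ⟨c, hc, hxc⟩ := hG.exists_adj_of_isEnd hxy Finset.mem_univ hZ
    have h1 := hXY a ha b hb
    have h2 := hXZ a ha c hc
    have h3 := hYZ b hb c hc
    have := hclaw x a b c hxa hxb hxc
    simp only [← Subtype.ext_iff] at this
    simp only [comap_adj, Function.Embedding.subtype_apply] at h1 h2 h3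
    tauto

theorem ConnectedComponent.nonempty_iso_pathGraph {C : G.ConnectedComponent} {w x y z : V}
    (hw : G.connectedComponentMk w = C) (hwx : w = x ∨ w = y ∨ w = z) (hxz : x ≠ z)
    (hxy : G.Adj x y) (hyz : G.Adj y z) (hx : ∀ t, G.Adj x t → t = y) (hz : ∀ t, G.Adj z t → t = y)
    (hy : ∀ t, G.Adj y t → t = x ∨ t = z) : Nonempty (C.toSimpleGraph ≃g pathGraph 3) := by
  have hyC : y ∈ C.supp := by
    rw [ConnectedComponent.mem_supp_iff, ← hw, ConnectedComponent.eq]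
    rcases hwx with rfl | rfl | rfl
    · exact hxy.symm.reachable
    · exact Reachable.refl _
    · exact hyz.reachable
  have hxC : x ∈ C.supp := C.mem_supp_of_adj_mem_supp hyC hxy.symm
  have hzC : z ∈ C.supp := C.mem_supp_of_adj_mem_supp hyC hyz
  have hxz' : ¬ G.Adj x z := fun h => hyz.ne (hx z h).symm
  have hsupp : ∀ v ∈ C.supp, v = x ∨ v = y ∨ v = z := by
    intro v hv
    by_contra hcon
    rw [ConnectedComponent.mem_supp_iff, ← (ConnectedComponent.mem_supp_iff _ _).1 hyC,
      ConnectedComponent.eq] at hv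
    obtain ⟨p⟩ := hv.symm
    obtain ⟨d, -, h1, h2⟩ := p.exists_boundary_dart {v | v = x ∨ v = y ∨ v = z}
      (Or.inr (Or.inl rfl)) hcon
    have hd := d.adj
    rcases h1 with h | h | h <;> rw [h] at hd
    · exact h2 (Or.inr (Or.inl (hx _ hd)))
    · exact h2 ((hy _ hd).imp id Or.inr)
    · exact h2 (Or.inr (Or.inl (hz _ hd)))
  let f : Fin 3 → C := ![⟨x, hxC⟩, ⟨y, hyC⟩, ⟨z, hzC⟩]
  have hf : Function.Bijective f := by
    constructor
    · have h1 := hxy.ne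
      have h2 := hyz.ne
      intro i j hij
      fin_cases i <;> fin_cases j <;> simp_all [f, Subtype.ext_iff]
    · rintro ⟨v, hv⟩
      rcases hsupp v hv with rfl | rfl | rfl
      · exact ⟨0, rfl⟩
      · exact ⟨1, rfl⟩
      · exact ⟨2, rfl⟩
  refine ⟨(RelIso.mk (Equiv.ofBijective f hf) ?_ : pathGraph 3 ≃g C.toSimpleGraph).symm⟩
  have hzx' : ¬ G.Adj z x := fun h => hxz' h.symm
  intro i j
  change G.Adj (f i) (f j) ↔ _
  rw [pathGraph_adj]
  fin_cases i <;> fin_cases j <;> simp [f, hxy, hyz, hxy.symm, hyz.symm, hxz', hzx']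

/-- `H` is the union of the chosen paths. Recording the neighbours of each path vertex is enough to
identify the components of `H`. -/
theorem PathPartition.exists_le [DecidableEq V] {U : Finset V} (h : G.PathPartition U) :
    ∃ H ≤ G, (∀ a b, H.Adj a b → a ∈ U) ∧ ∀ w ∈ U, ∃ x y z, (w = x ∨ w = y ∨ w = z) ∧ x ≠ z ∧
      H.Adj x y ∧ H.Adj y z ∧ (∀ t, H.Adj x t → t = y) ∧ (∀ t, H.Adj z t → t = y) ∧
      ∀ t, H.Adj y t → t = x ∨ t = z := by
  induction h with
  | empty => exact ⟨⊥, bot_le, by simp, by simp⟩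
  | @step U x y z hU hx hy hz hxz hxy hyz ih =>
    obtain ⟨H, hH, hHU, hpath⟩ := ih
    have h1 := hxy.ne
    have h2 := hyz.ne
    have hHU' : ∀ a b, H.Adj a b → b ∈ U := fun a b hab => hHU b a hab.symm
    let H' : SimpleGraph V :=
      { Adj := fun a b => H.Adj a b ∨ (a = x ∧ b = y) ∨ (a = y ∧ b = x) ∨ (a = y ∧ b = z) ∨
          (a = z ∧ b = y)
        symm := ⟨fun a b hab => by have := H.adj_comm a b; tauto⟩
        loopless := ⟨fun a ha => by have := H.irrefl (v := a); grind⟩ }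
    have hadj : ∀ a b, H'.Adj a b ↔ H.Adj a b ∨ (a = x ∧ b = y) ∨ (a = y ∧ b = x) ∨
      (a = y ∧ b = z) ∨ (a = z ∧ b = y) := fun a b => Iff.rfl
    refine ⟨H', ?_, ?_, ?_⟩
    · intro a b hab
      rcases hab with h | ⟨rfl, rfl⟩ | ⟨rfl, rfl⟩ | ⟨rfl, rfl⟩ | ⟨rfl, rfl⟩
      · exact hH h
      · exact hxy
      · exact hxy.symm
      · exact hyz
      · exact hyz.symm
    · intro a b hab
      have := hHU a b
      rw [hadj] at hab
      simp only [Finset.mem_insert]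
      tauto
    · intro w hw
      have hold : ∀ a ∈ U, ∀ t, H'.Adj a t → H.Adj a t := by
        intro a ha t hat
        rw [hadj] at hat
        have h1 := ne_of_mem_of_not_mem ha hx
        have h2 := ne_of_mem_of_not_mem ha hy
        have h3 := ne_of_mem_of_not_mem ha hz
        tauto
      by_cases hwU : w ∈ U
      · obtain ⟨a, b, c, hw, hac, hab, hbc, h1, h2, h3⟩ := hpath w hwU
        exact ⟨a, b, c, hw, hac, Or.inl hab, Or.inl hbc,
          fun t ht => h1 t (hold a (hHU a b hab) t ht),
          fun t ht => h2 t (hold c (hHU c b hbc.symm) t ht),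
          fun t ht => h3 t (hold b (hHU b c hbc) t ht)⟩
      · have hxt := hHU x
        have hyt := hHU y
        have hzt := hHU z
        refine ⟨x, y, z, by simpa [hwU] using hw, hxz, by simp [hadj], by simp [hadj], ?_, ?_, ?_⟩
        all_goals
          intro t ht
          rw [hadj] at ht
          grind

theorem PathPartition.hasLambdaFactor [DecidableEq V] {U : Finset V} (h : G.PathPartition U)
    (hU : ∀ v, v ∈ U) : G.HasLambdaFactor := by
  obtain ⟨H, hH, -, hpath⟩ := h.exists_le
  refine ⟨toSubgraph H hH, fun C => ?_, toSubgraph.isSpanning H hH⟩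
  obtain ⟨w, hw⟩ := C.exists_rep
  obtain ⟨x, y, z, hwx, hxz, hxy, hyz, hx, hz, hy⟩ := hpath w (hU _)
  refine ConnectedComponent.nonempty_iso_pathGraph (x := ⟨x, trivial⟩) (y := ⟨y, trivial⟩)
    (z := ⟨z, trivial⟩) hw (by simpa [Subtype.ext_iff] using hwx) (fun e => hxz (Subtype.ext_iff.1 e)) hxy hyz ?_ ?_ ?_
  · exact fun t ht => Subtype.ext (hx t ht)
  · exact fun t ht => Subtype.ext (hz t ht)
  · exact fun t ht => (hy t ht).imp Subtype.ext Subtype.ext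

end

end SimpleGraph

theorem mainTheorem3 {V : Type*} [Fintype V] (G : SimpleGraph V)
    (hconn : G.IsKVertexConnected 3) (hclaw : G.IsClawFree)
    (hcard : Fintype.card V % 3 = 2) (x y : V) (hxy : G.Adj x y) :
    (G.deleteVertices {x, y}).HasLambdaFactor := by
  classical
  refine ((hconn.isChain_deleteVertices hclaw.noClaw hxy.ne).pathPartition
    (hclaw.noClaw.induce _) ?_).hasLambdaFactor Finset.mem_univ
  have h1 : Fintype.card ↥({x, y} : Set V) = 2 := by
    rw [← Set.toFinset_card]
    simp [Finset.card_pair hxy.ne]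
  have h2 := Fintype.card_compl_set ({x, y} : Set V)
  have h3 : Fintype.card ↥({x, y} : Set V) ≤ Fintype.card V := set_fintype_card_le_univ _
  rw [Finset.card_univ, h2]
  omega
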